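/- All graphs are finite and simple. A \emph{grid path} is a finite sequence of consecutive, pairwise distinct edges of the rectangular grid $\mathbb{Z}^2$ in the plane (it may pass through a grid-point more than once); its number of \emph{bends} is the number of times it switches direction between horizontal and vertical. The \emph{bend-number} $b(G)$ of a graph $G$ is the minimum $k$ for which one can assign to every vertex $v$ of $G$ a grid path $P(v)$ with at most $k$ bends such that two distinct vertices $v,w$ are adjacent in $G$ if and only if $P(v)$ and $P(w)$ share at least one grid-edge. A \emph{$k$-tree} is a graph that can be constructed starting with a $(k+1)$-clique and in every step attaching a new vertex to a $k$-clique of the already constructed graph. The \emph{treewidth} $\mathrm{tw}(G)$ is the minimum $k$ such that $G$ is a subgraph of some $k$-tree. Theorem. Let $k\geq 2$. For every graph $G$ with $\mathrm{tw}(G)\leq k$ we have $b(G)\leq 2k-2$. Moreover, this bound is best possible: for every $k\geq 2$ there is a graph $G$ with $\mathrm{tw}(G)=k$ and $b(G)=2k-2$. -/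

import Mathlib

/-- The rectangular grid in the plane: the vertices are the integer points, two of them being
adjacent iff they agree in one coordinate and differ by exactly `1` in the other. -/
noncomputable def planeGrid : SimpleGraph (ℤ × ℤ) :=
  (SimpleGraph.hasse ℤ).boxProd (SimpleGraph.hasse ℤ)

/-- `true` for a horizontal (oriented) grid-edge, `false` for a vertical one. -/
def isHorizontalDart (d : planeGrid.Dart) : Bool :=
  decide (d.fst.2 = d.snd.2)

/-- The number of positions at which two consecutive entries of a list differ. -/
def switchCount : List Bool → ℕ
  | [] => 0
  | [_] => 0
  | a :: b :: l => (if a = b then 0 else 1) + switchCount (b :: l)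

/-- A grid path: a finite sequence of consecutive, pairwise distinct grid-edges.
A grid path may run through (cross itself in) the same grid-point several times. -/
structure GridPath where
  /-- the start point -/
  start : ℤ × ℤ
  /-- the end point -/
  finish : ℤ × ℤ
  /-- the underlying walk in the grid -/
  walk : planeGrid.Walk start finish
  /-- no grid-edge is used twice -/
  isTrail : walk.IsTrail

/-- The set of grid-edges of a grid path. -/
def GridPath.edgeSet (P : GridPath) : Set (Sym2 (ℤ × ℤ)) :=
  {e | e ∈ P.walk.edges}

/-- The number of bends of a grid path: how often the direction switches between horizontal and
vertical along the path. -/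
noncomputable def GridPath.bends (P : GridPath) : ℕ :=
  switchCount (P.walk.darts.map isHorizontalDart)

/-- `P` is an EPG representation of `G`: two distinct vertices are adjacent iff their grid paths
have at least one grid-edge in common. -/
def IsEPGRepresentation {V : Type*} (G : SimpleGraph V) (P : V → GridPath) : Prop :=
  ∀ v w : V, v ≠ w → (G.Adj v w ↔ ((P v).edgeSet ∩ (P w).edgeSet).Nonempty)

/-- `G` has an EPG representation in which every grid path has at most `k` bends. -/
def HasBendRepresentation {V : Type*} (k : ℕ) (G : SimpleGraph V) : Prop :=
  ∃ P : V → GridPath, IsEPGRepresentation G P ∧ ∀ v : V, (P v).bends ≤ k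

/-- The bend-number of `G`: the least `k` such that `G` has a `k`-bend representation
(`⊤` if there is none). -/
noncomputable def bendNumber {V : Type*} (G : SimpleGraph V) : ℕ∞ :=
  ⨅ (k : ℕ) (_ : HasBendRepresentation k G), (k : ℕ∞)

/-- `KTreeBuilt k H s`: the subgraph of `H` induced by `s` can be constructed starting with a
`(k+1)`-clique and in every step attaching a new vertex to a `k`-clique of the graph constructed
so far. -/
inductive KTreeBuilt {W : Type*} (k : ℕ) (H : SimpleGraph W) : Finset W → Prop
  | base (s : Finset W) (hs : H.IsNClique (k + 1) s) : KTreeBuilt k H s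
  | attach (s : Finset W) (v : W) (hv : v ∉ s) (c : Finset W) (hcs : c ⊆ s)
      (hc : H.IsNClique k c) (hadj : ∀ w ∈ s, H.Adj v w ↔ w ∈ c)
      (hs : KTreeBuilt k H s) : KTreeBuilt k H (Finset.cons v s hv)

/-- `H` is a `k`-tree. -/
def IsKTree {W : Type*} (k : ℕ) (H : SimpleGraph W) : Prop :=
  ∃ s : Finset W, (∀ v : W, v ∈ s) ∧ KTreeBuilt k H s

/-- `G` is (isomorphic to) a subgraph of some `k`-tree. -/
def IsPartialKTree {V : Type*} (k : ℕ) (G : SimpleGraph V) : Prop :=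
  ∃ (n : ℕ) (H : SimpleGraph (Fin n)), IsKTree k H ∧ G.IsContained H

/-- The treewidth of `G`: the least `k` such that `G` is a subgraph of some `k`-tree
(`⊤` if there is none). -/
noncomputable def treewidth {V : Type*} (G : SimpleGraph V) : ℕ∞ :=
  ⨅ (k : ℕ) (_ : IsPartialKTree k G), (k : ℕ∞)

/-! Lower bound. Take the complete bipartite graph with parts of sizes `k` and `N`, `N` huge. If all
paths had fewer than `2 * k - 2` bends, the `k` paths of the small part would use boundedly many
grid lines, so their ends together with all points having both coordinates among those of the lines
would form a bounded set `S`. The `N` other paths are pairwise edge-disjoint, hence one of them has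
no edge at `S`. Along that path every edge lies on at most one of the `k` paths, going straight
never changes which one, and at a bend the two edges are never both on such paths. Passing from one
of them to another therefore costs two bends, and meeting all `k` costs `2 * k - 2`
(`two_mul_le_bends_add_two`). The treewidth is `k` because `k`-trees are `k`-degenerate.

Upper bound. A `k`-tree is built vertex by vertex, every path being a list of at most `2 * k + 1`
rational coordinates, hence at most `2 * k - 1` segments. Rational coordinates always leave room for
new lines. The invariant (`Layout`) gives each clique with at most `k` vertices a configuration
`Conf`, made of germs: statements about who uses a line just to the right of a point. A new path
touches old lines only in short intervals free of distinguished coordinates, so all old germs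
survive.

The count works as follows (`Conf.existsConf`). If the clique members face each other and fewer than
`k` are neighbours, a path touches the neighbours' lines on both sides of some `p` and crosses `p`
on a line of its own; it then faces everybody. If all `k` are neighbours, a zigzag with `2 * k - 1`
segments touches all of them but has no segment left for facing them; it becomes the exceptional
vertex `z`, which compensates by running together with each member of `R`. Later, a vertex adjacent
to `z` and some `v` in `R` meets both with a single segment, and the saved segments let it face the
rest in both directions. -/

/-! ### Meeting many edge-disjoint paths costs bends -/

theorem planeGrid_adj {a b : ℤ × ℤ} : planeGrid.Adj a b ↔
    (a.2 = b.2 ∧ (a.1 + 1 = b.1 ∨ b.1 + 1 = a.1)) ∨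
      (a.1 = b.1 ∧ (a.2 + 1 = b.2 ∨ b.2 + 1 = a.2)) := by
  simp only [planeGrid, SimpleGraph.boxProd_adj, SimpleGraph.hasse_adj,
    Order.covBy_iff_add_one_eq]
  tauto

/-- Along a list in which consecutive entries of the same direction have the same colour, and
consecutive entries of different directions are not both coloured, a new colour costs two
switches of direction. -/
theorem two_mul_card_colours_le {α κ : Type*} [DecidableEq κ] (dir : α → Bool)
    (col : α → Option κ) (l : List α)
    (h : l.IsChain (fun e f => (dir e = dir f → col e = col f) ∧
      (dir e ≠ dir f → col e = none ∨ col f = none))) :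
    2 * (l.filterMap col).toFinset.card ≤
      switchCount (l.map dir) + (l.head?.bind col).elim 1 (fun _ => 2) := by
  -- The last summand is a potential: a coloured first entry already accounts for its colour, an
  -- uncoloured one is only one switch away from a new colour.
  induction l with
  | nil => simp
  | cons e r ih =>
    cases r with
    | nil => cases hc : col e <;> simp [hc, switchCount]
    | cons f r =>
      rw [List.isChain_cons_cons] at h
      obtain ⟨⟨h1, h2⟩, h3⟩ := h
      have ih := ih h3
      simp only [List.map_cons, switchCount, List.head?_cons, Option.bind_some] at ih ⊢
      by_cases hd : dir e = dir f
      · have hc := h1 hd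
        have : ((e :: f :: r).filterMap col).toFinset = ((f :: r).filterMap col).toFinset := by
          cases hf : col f <;> simp [hc, hf]
        rw [this, hc]
        simpa [hd] using ih
      · rw [if_neg hd]
        cases he : col e with
        | none =>
          rw [List.filterMap_cons_none he]
          cases hf : col f <;> simp [hf] at ih ⊢ <;> omega
        | some i =>
          have hf : col f = none := by
            rcases h2 hd with h | h
            · simp [he] at h
            · exact h
          rw [List.filterMap_cons_some he, List.toFinset_cons]
          have := Finset.card_insert_le i ((f :: r).filterMap col).toFinset
          rw [hf] at ih
          simp at ih ⊢
          omega

/-- The coordinate of the grid line on which a dart lies. -/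
noncomputable def lineCoord (d : planeGrid.Dart) : ℤ :=
  if isHorizontalDart d then d.fst.2 else d.fst.1

theorem isHorizontalDart_eq_true {d : planeGrid.Dart} :
    isHorizontalDart d = true ↔ d.fst.2 = d.snd.2 := by
  simp [isHorizontalDart]

theorem fst_fst_eq_of_not_isHorizontalDart {d : planeGrid.Dart}
    (h : ¬ isHorizontalDart d = true) : d.fst.1 = d.snd.1 := by
  rw [isHorizontalDart_eq_true] at h
  have := planeGrid_adj.1 d.adj
  tauto

theorem lineCoord_eq_of_dartAdj {d e : planeGrid.Dart} (h : planeGrid.DartAdj d e)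
    (hde : isHorizontalDart d = isHorizontalDart e) : lineCoord d = lineCoord e := by
  unfold lineCoord
  rw [← hde]
  have h' : d.snd = e.fst := h
  split_ifs with hd
  · rw [isHorizontalDart_eq_true.1 hd, h']
  · rw [fst_fst_eq_of_not_isHorizontalDart hd, h']

/-- The line changes only at a bend. Horizontal and vertical lines are pooled in one set of
coordinates, which is harmless as only a bound on crossing points is wanted. -/
theorem exists_lineCoords (l : List planeGrid.Dart) (h : l.IsChain planeGrid.DartAdj) :
    ∃ T : Finset ℤ, T.card ≤ switchCount (l.map isHorizontalDart) + 1 ∧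
      ∀ d ∈ l, lineCoord d ∈ T := by
  induction l with
  | nil => exact ⟨∅, by simp⟩
  | cons d r ih =>
    cases r with
    | nil => exact ⟨{lineCoord d}, by simp⟩
    | cons e r =>
      rw [List.isChain_cons_cons] at h
      obtain ⟨T, hT, hmem⟩ := ih h.2
      by_cases hd : isHorizontalDart d = isHorizontalDart e
      · refine ⟨T, by simpa [switchCount, hd] using hT, ?_⟩
        intro x hx
        rcases List.mem_cons.1 hx with rfl | hx
        · rw [lineCoord_eq_of_dartAdj h.1 hd]
          exact hmem _ (by simp)
        · exact hmem x hx
      · refine ⟨insert (lineCoord d) T, ?_, ?_⟩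
        · have := Finset.card_insert_le (lineCoord d) T
          simp only [List.map_cons, switchCount, if_neg hd] at hT ⊢
          omega
        · intro x hx
          rcases List.mem_cons.1 hx with rfl | hx
          · simp
          · exact Finset.mem_insert_of_mem (hmem x hx)

theorem mem_of_mem_edges {u v : ℤ × ℤ} {w : planeGrid.Walk u v} {T : Finset ℤ}
    (hT : ∀ d ∈ w.darts, lineCoord d ∈ T) {p r : ℤ × ℤ} (h : s(p, r) ∈ w.edges) :
    (p.2 = r.2 → p.2 ∈ T) ∧ (p.1 = r.1 → p.1 ∈ T) := by
  have hadj := w.adj_of_mem_edges h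
  obtain ⟨d, hd, hde⟩ := List.mem_map.1 h
  have hmem := hT d hd
  have hne := planeGrid_adj.1 hadj
  rcases SimpleGraph.dart_edge_eq_mk'_iff'.1 hde with ⟨h1, h2⟩ | ⟨h1, h2⟩
  all_goals
    constructor
    · intro hp
      have : isHorizontalDart d = true := by rw [isHorizontalDart_eq_true, h1, h2, hp]
      simpa [lineCoord, this, h1, hp] using hmem
    · intro hp
      have : ¬ isHorizontalDart d = true := by
        rw [isHorizontalDart_eq_true, h1, h2]
        omega
      simpa [lineCoord, this, h1, hp] using hmem

/-- Away from its ends and its bends, a grid path goes straight on. -/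
theorem mem_edges_of_straight {u v : ℤ × ℤ} {w : planeGrid.Walk u v} (hw : w.IsTrail)
    {T : Finset ℤ} (hT : ∀ d ∈ w.darts, lineCoord d ∈ T) {p q r : ℤ × ℤ}
    (hu : p ≠ u) (hv : p ≠ v) (hp : ¬ (p.1 ∈ T ∧ p.2 ∈ T)) (hpr : planeGrid.Adj p r)
    (hqr : q ≠ r) (hd : p.2 = q.2 ↔ p.2 = r.2) (h : s(p, q) ∈ w.edges) : s(p, r) ∈ w.edges := by
  -- Parity replaces following the trail: at a point that is not an end the number of its edges is
  -- even, so a second edge exists. It cannot be perpendicular to the first, since then both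
  -- coordinates of `p` would lie in `T`.
  have heven : Even (w.edges.countP fun e => p ∈ e) :=
    (hw.even_countP_edges_iff p).2 fun _ => ⟨hu, hv⟩
  have hex : ∃ e ∈ w.edges, p ∈ e ∧ e ≠ s(p, q) := by
    by_contra! hcon
    have : w.edges.countP (fun e => p ∈ e) = w.edges.countP (fun e => e == s(p, q)) := by
      apply List.countP_congr
      intro e he
      have := hcon e he
      simp only [decide_eq_true_eq, beq_iff_eq]
      exact ⟨this, fun h => by simp [h]⟩
    rw [this] at heven
    have h1 : w.edges.countP (fun e => e == s(p, q)) = 1 := by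
      have := List.count_eq_one_of_mem hw.edges_nodup h
      simpa [List.count] using this
    rw [h1] at heven
    exact absurd heven (by decide)
  obtain ⟨e, he, hpe, hne⟩ := hex
  obtain ⟨r', rfl⟩ := Sym2.mem_iff_exists.1 hpe
  have hr'q : r' ≠ q := fun h => hne (by rw [h])
  by_cases hrr : r' = r
  · exact hrr ▸ he
  exfalso
  obtain ⟨m1, m2⟩ := mem_of_mem_edges hT h
  obtain ⟨m3, m4⟩ := mem_of_mem_edges hT he
  have a1 := planeGrid_adj.1 (w.adj_of_mem_edges h)
  have a2 := planeGrid_adj.1 (w.adj_of_mem_edges he)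
  have a3 := planeGrid_adj.1 hpr
  rcases a1 with ⟨b1, c1⟩ | ⟨b1, c1⟩
  · rcases a2 with ⟨b2, c2⟩ | ⟨b2, c2⟩
    · rcases a3 with ⟨b3, c3⟩ | ⟨b3, c3⟩
      · have n1 : r'.1 ≠ q.1 := fun h => hr'q (Prod.ext h (b2.symm.trans b1))
        have n2 : r'.1 ≠ r.1 := fun h => hrr (Prod.ext h (b2.symm.trans b3))
        have n3 : q.1 ≠ r.1 := fun h => hqr (Prod.ext h (b1.symm.trans b3))
        clear hp m1 m2 m3 m4 hd
        omega
      · have := hd.1 b1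
        clear hp m1 m2 m3 m4 hd
        omega
    · exact hp ⟨m4 b2, m1 b1⟩
  · rcases a2 with ⟨b2, c2⟩ | ⟨b2, c2⟩
    · exact hp ⟨m2 b1, m3 b2⟩
    · rcases a3 with ⟨b3, c3⟩ | ⟨b3, c3⟩
      · have := hd.2 b3
        clear hp m1 m2 m3 m4 hd
        omega
      · have n1 : r'.2 ≠ q.2 := fun h => hr'q (Prod.ext (b2.symm.trans b1) h)
        have n2 : r'.2 ≠ r.2 := fun h => hrr (Prod.ext (b2.symm.trans b3) h)
        have n3 : q.2 ≠ r.2 := fun h => hqr (Prod.ext (b1.symm.trans b3) h)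
        clear hp m1 m2 m3 m4 hd
        omega

/-- The grid-edges incident to a point of `S`. -/
def incidentEdges (S : Finset (ℤ × ℤ)) : Finset (Sym2 (ℤ × ℤ)) :=
  S.biUnion fun p => {s(p, (p.1 + 1, p.2)), s(p, (p.1 - 1, p.2)), s(p, (p.1, p.2 + 1)),
    s(p, (p.1, p.2 - 1))}

theorem card_incidentEdges_le (S : Finset (ℤ × ℤ)) : (incidentEdges S).card ≤ S.card * 4 :=
  Finset.card_biUnion_le_card_mul _ _ _ fun _ _ => Finset.card_le_four

theorem mem_incidentEdges {S : Finset (ℤ × ℤ)} {p q : ℤ × ℤ} (hp : p ∈ S)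
    (h : planeGrid.Adj p q) : s(p, q) ∈ incidentEdges S := by
  obtain ⟨x, y⟩ := p
  obtain ⟨x', y'⟩ := q
  refine Finset.mem_biUnion.2 ⟨_, hp, ?_⟩
  have := planeGrid_adj.1 h
  dsimp only at this
  simp only [Finset.mem_insert, Finset.mem_singleton, Sym2.congr_right, Prod.mk.injEq]
  omega

/-- A grid path that meets `m` pairwise edge-disjoint grid paths, but has no edge at one of their
ends or at a crossing point of two of their lines, has at least `2 * m - 2` bends. -/
theorem two_mul_le_bends_add_two {m : ℕ} (A : Fin m → GridPath) (B : GridPath)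
    (hdisj : ∀ i j, i ≠ j → Disjoint (A i).edgeSet (A j).edgeSet)
    (hmeet : ∀ i, ((A i).edgeSet ∩ B.edgeSet).Nonempty) (T : Finset ℤ)
    (hT : ∀ i, ∀ d ∈ (A i).walk.darts, lineCoord d ∈ T) (S : Finset (ℤ × ℤ))
    (hTS : T ×ˢ T ⊆ S) (hstart : ∀ i, (A i).start ∈ S) (hfinish : ∀ i, (A i).finish ∈ S)
    (hB : ∀ e ∈ B.walk.edges, e ∉ incidentEdges S) : 2 * m ≤ B.bends + 2 := by
  classical
  let col : planeGrid.Dart → Option (Fin m) := fun d =>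
    if h : ∃ i, d.edge ∈ (A i).edgeSet then some h.choose else none
  have hcol : ∀ d i, col d = some i ↔ d.edge ∈ (A i).edgeSet := by
    intro d i
    constructor
    · intro h
      by_cases hex : ∃ i, d.edge ∈ (A i).edgeSet
      · simp only [col, dif_pos hex, Option.some.injEq] at h
        exact h ▸ hex.choose_spec
      · simp [col, dif_neg hex] at h
    · intro h
      have hex : ∃ i, d.edge ∈ (A i).edgeSet := ⟨i, h⟩
      simp only [col, dif_pos hex, Option.some.injEq]
      by_contra hne
      exact Set.disjoint_left.1 (hdisj _ _ hne) hex.choose_spec h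
  have hcolnone : ∀ d, (∀ i, d.edge ∉ (A i).edgeSet) → col d = none := by
    intro d h
    simp [col, h]
  have hchain : B.walk.darts.IsChain (fun e f =>
      (isHorizontalDart e = isHorizontalDart f → col e = col f) ∧
      (isHorizontalDart e ≠ isHorizontalDart f → col e = none ∨ col f = none)) := by
    have hnd : (B.walk.darts.map SimpleGraph.Dart.edge).Pairwise (· ≠ ·) := B.isTrail.edges_nodup
    rw [List.pairwise_map] at hnd
    have hch := B.walk.isChain_dartAdj_darts
    have hall : B.walk.darts.Pairwise (fun e f => e ∈ B.walk.darts ∧ f ∈ B.walk.darts) := by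
      refine List.pairwise_iff_forall_sublist.2 fun {a b} hs =>
        ⟨hs.subset (by simp), hs.subset (by simp)⟩
    have hcc := (hnd.and hall).isChain
    rw [List.isChain_iff_getElem] at hch hcc ⊢
    intro n hn
    obtain ⟨hne, he, hf⟩ := hcc n hn
    have hadj := hch n hn
    revert hne he hf hadj
    generalize B.walk.darts[n] = e
    generalize B.walk.darts[n + 1] = f
    intro hne he hf hadj
    obtain ⟨⟨q, p⟩, hqp⟩ := e
    obtain ⟨⟨p', r⟩, hpr⟩ := f
    obtain rfl : p = p' := hadj
    simp only at hqp hpr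
    have hpq := hqp.symm
    have hpS : p ∉ S := fun hp => by
      refine hB s(p, r) (List.mem_map.2 ⟨_, hf, rfl⟩) (mem_incidentEdges hp hpr)
    have hpT : ¬ (p.1 ∈ T ∧ p.2 ∈ T) := fun h => hpS (hTS (by simpa using h))
    have hedge : (⟨(q, p), hqp⟩ : planeGrid.Dart).edge = s(p, q) := Sym2.eq_swap
    have hedge' : (⟨(p, r), hpr⟩ : planeGrid.Dart).edge = s(p, r) := rfl
    have hqr : q ≠ r := by
      rintro rfl
      exact hne (by rw [hedge, hedge'])
    have hu : ∀ i, p ≠ (A i).start := fun i h => hpS (h ▸ hstart i)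
    have hv : ∀ i, p ≠ (A i).finish := fun i h => hpS (h ▸ hfinish i)
    constructor
    · intro hdir
      have hd : p.2 = q.2 ↔ p.2 = r.2 := by
        simpa [isHorizontalDart, eq_comm] using hdir
      have key : ∀ i, s(p, q) ∈ (A i).walk.edges ↔ s(p, r) ∈ (A i).walk.edges := fun i =>
        ⟨mem_edges_of_straight (A i).isTrail (hT i) (hu i) (hv i) hpT hpr hqr hd,
         mem_edges_of_straight (A i).isTrail (hT i) (hu i) (hv i) hpT hpq hqr.symm hd.symm⟩
      ext i
      rw [hcol, hcol, hedge, hedge']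
      exact key i
    · intro hdir
      -- Two coloured edges at a bend put `p` on a horizontal and on a vertical line recorded in
      -- `T`, hence into `S`.
      by_contra! hcon
      obtain ⟨i, hi⟩ := Option.ne_none_iff_exists'.1 hcon.1
      obtain ⟨j, hj⟩ := Option.ne_none_iff_exists'.1 hcon.2
      rw [hcol, hedge] at hi
      rw [hcol, hedge'] at hj
      obtain ⟨m1, m2⟩ := mem_of_mem_edges (hT i) hi
      obtain ⟨m3, m4⟩ := mem_of_mem_edges (hT j) hj
      have hd : ¬ (p.2 = q.2 ↔ p.2 = r.2) := by
        simpa [isHorizontalDart, eq_comm] using hdir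
      rcases planeGrid_adj.1 hpq with ⟨c, -⟩ | ⟨c, -⟩ <;>
        rcases planeGrid_adj.1 hpr with ⟨c', -⟩ | ⟨c', -⟩
      · exact hd (by simp [c, ← c'])
      · exact hpT ⟨m4 c', m1 c⟩
      · exact hpT ⟨m2 c, m3 c'⟩
      · refine hd ⟨fun h => absurd (Prod.ext c h) hpq.ne, fun h => absurd (Prod.ext c' h) hpr.ne⟩
  have hcard := two_mul_card_colours_le isHorizontalDart col B.walk.darts hchain
  have huniv : (B.walk.darts.filterMap col).toFinset = Finset.univ := by
    ext i
    simp only [List.mem_toFinset, List.mem_filterMap, Finset.mem_univ, iff_true]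
    obtain ⟨e, he, heB⟩ := hmeet i
    obtain ⟨d, hd, rfl⟩ := List.mem_map.1 (show e ∈ B.walk.edges from heB)
    exact ⟨d, hd, (hcol d i).2 he⟩
  rw [huniv, Finset.card_univ, Fintype.card_fin] at hcard
  have : (B.walk.darts.head?.bind col).elim 1 (fun _ => 2) ≤ 2 := by
    cases B.walk.darts.head?.bind col <;> simp
  unfold GridPath.bends
  omega

/-! ### Bend-number of complete bipartite graphs -/

/-- The complete bipartite graph with parts of `k` and `N` vertices. -/
def bipartiteFin (k N : ℕ) : SimpleGraph (Fin (k + N)) where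
  Adj i j := (i.val < k ∧ k ≤ j.val) ∨ (j.val < k ∧ k ≤ i.val)
  symm := ⟨fun i j h => by omega⟩
  loopless := ⟨fun i h => by omega⟩

theorem bipartiteFin_adj {k N : ℕ} {i j : Fin (k + N)} : (bipartiteFin k N).Adj i j ↔
    (i.val < k ∧ k ≤ j.val) ∨ (j.val < k ∧ k ≤ i.val) := Iff.rfl

/-- The bound on `N` is four edges for each of the at most `(k * (2 * k - 2)) ^ 2` points of the
product set and the `2 * k` ends: a path with at most `2 * k - 3` bends uses at most `2 * k - 2`
lines. -/
theorem le_of_hasBendRepresentation_bipartiteFin {k N j : ℕ}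
    (hN : ((k * (2 * k - 2)) ^ 2 + 2 * k) * 4 < N)
    (h : HasBendRepresentation j (bipartiteFin k N)) : 2 * k - 2 ≤ j := by
  classical
  by_contra! hj
  obtain ⟨P, hP, hbend⟩ := h
  let A : Fin k → GridPath := fun i => P (Fin.castAdd N i)
  let B : Fin N → GridPath := fun i => P (Fin.natAdd k i)
  choose T hTcard hT using fun i : Fin k =>
    exists_lineCoords (A i).walk.darts (A i).walk.isChain_dartAdj_darts
  have hTcard' : ∀ i, (T i).card ≤ 2 * k - 2 := fun i => by
    have h1 := hTcard i
    have h2 : (A i).bends ≤ j := hbend _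
    unfold GridPath.bends at h2
    omega
  let T' : Finset ℤ := Finset.univ.biUnion T
  have hT' : T'.card ≤ k * (2 * k - 2) := by
    simpa using Finset.card_biUnion_le_card_mul Finset.univ T _ fun i _ => hTcard' i
  let S : Finset (ℤ × ℤ) := T' ×ˢ T' ∪ (Finset.univ.image (fun i => (A i).start) ∪
    Finset.univ.image (fun i => (A i).finish))
  have hS : S.card ≤ (k * (2 * k - 2)) ^ 2 + 2 * k := by
    refine (Finset.card_union_le _ _).trans (add_le_add ?_ ?_)
    · rw [Finset.card_product, sq]
      exact Nat.mul_le_mul hT' hT'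
    · refine (Finset.card_union_le _ _).trans ?_
      rw [two_mul]
      refine add_le_add ?_ ?_ <;> exact Finset.card_image_le.trans (by simp)
  have hex : ∀ n : Fin N, ∃ e, e ∈ (B n).walk.edges ∧ e ∈ incidentEdges S := by
    intro n
    by_contra! hcon
    have hle := two_mul_le_bends_add_two A (B n) ?_ ?_ T' ?_ S ?_ ?_ ?_ hcon
    · have : (B n).bends ≤ j := hbend _
      omega
    · intro i i' hii
      rw [Set.disjoint_iff_inter_eq_empty, ← Set.not_nonempty_iff_eq_empty,
        ← hP _ _ (by simpa using hii), bipartiteFin_adj]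
      simp
    · intro i
      rw [← hP _ _ (by simp [Fin.ext_iff]; omega), bipartiteFin_adj]
      simp
    · intro i d hd
      exact Finset.mem_biUnion.2 ⟨i, Finset.mem_univ _, hT i d hd⟩
    · exact Finset.subset_union_left
    · intro i
      simp [S]
    · intro i
      simp [S]
  -- The chosen edges are distinct because the large part is independent, so `N` cannot exceed the
  -- number of edges at `S`.
  choose g hgB hgS using hex
  have hinj : Function.Injective g := by
    intro n n' hnn
    by_contra hne
    have := (hP (Fin.natAdd k n) (Fin.natAdd k n') (by simpa using hne)).2
      ⟨g n, hgB n, by rw [hnn]; exact hgB n'⟩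
    rw [bipartiteFin_adj] at this
    simp at this
  have h1 : N ≤ (incidentEdges S).card := by
    simpa using Finset.card_le_card_of_injOn (s := Finset.univ) g (by simpa [Set.MapsTo] using hgS)
      hinj.injOn
  have := card_incidentEdges_le S
  omega

/-! ### Treewidth of complete bipartite graphs -/

/-- The `k`-tree in which `N` vertices are attached to the same `k`-clique. -/
def coneFin (k N : ℕ) : SimpleGraph (Fin (k + N)) where
  Adj i j := i ≠ j ∧ (i.val < k ∨ j.val < k)
  symm := ⟨fun _ _ h => ⟨h.1.symm, h.2.symm⟩⟩
  loopless := ⟨fun _ h => h.1 rfl⟩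

theorem card_filter_val_lt {n m : ℕ} (h : m ≤ n) :
    (Finset.univ.filter fun i : Fin n => i.val < m).card = m := by
  have : (Finset.univ.filter fun i : Fin n => i.val < m) =
      (Finset.univ : Finset (Fin m)).map (Fin.castLEEmb h) := by
    ext i
    simp only [Finset.mem_filter, Finset.mem_univ, true_and, Finset.mem_map]
    exact ⟨fun hi => ⟨⟨i, hi⟩, rfl⟩, fun ⟨a, ha⟩ => ha ▸ a.2⟩
  rw [this]
  simp

theorem kTreeBuilt_coneFin (k N m : ℕ) (hm : m + 1 ≤ N) :
    KTreeBuilt k (coneFin k N) (Finset.univ.filter fun i => i.val < k + 1 + m) := by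
  induction m with
  | zero =>
    refine .base _ ⟨?_, card_filter_val_lt (by omega)⟩
    intro i hi j hj hij
    simp only [Finset.coe_filter, Finset.mem_univ, true_and, Set.mem_ofPred_eq] at hi hj
    refine ⟨hij, ?_⟩
    rw [Ne, Fin.ext_iff] at hij
    omega
  | succ m ih =>
    let v : Fin (k + N) := ⟨k + 1 + m, by omega⟩
    have hv : v ∉ (Finset.univ.filter fun i : Fin (k + N) => i.val < k + 1 + m) := by simp [v]
    have := KTreeBuilt.attach _ v hv (Finset.univ.filter fun i => i.val < k) ?_ ?_ ?_
      (ih (by omega))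
    · convert this using 1
      ext i
      simp only [Finset.mem_filter, Finset.mem_univ, true_and, Finset.mem_cons, Fin.ext_iff, v]
      omega
    · intro i hi
      simp only [Finset.mem_filter, Finset.mem_univ, true_and] at hi ⊢
      omega
    · refine ⟨?_, card_filter_val_lt (by omega)⟩
      intro i hi j hj hij
      simp only [Finset.coe_filter, Finset.mem_univ, true_and, Set.mem_ofPred_eq] at hi hj
      exact ⟨hij, Or.inl hi⟩
    · intro w hw
      simp only [Finset.mem_filter, Finset.mem_univ, true_and, coneFin, Fin.ext_iff, v, Ne] at hw ⊢
      omega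

theorem isPartialKTree_bipartiteFin {k N : ℕ} (hN : 1 ≤ N) :
    IsPartialKTree k (bipartiteFin k N) := by
  refine ⟨k + N, coneFin k N, ⟨_, ?_, kTreeBuilt_coneFin k N (N - 1) (by omega)⟩, ?_⟩
  · intro v
    simp only [Finset.mem_filter, Finset.mem_univ, true_and]
    omega
  · refine SimpleGraph.IsContained.of_le fun i j h => ?_
    rw [bipartiteFin_adj] at h
    exact ⟨by rw [Ne, Fin.ext_iff]; omega, by omega⟩

/-- `k`-trees are `k`-degenerate. -/
theorem KTreeBuilt.exists_card_le {W : Type*} {k : ℕ} {H : SimpleGraph W} {s : Finset W}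
    (h : KTreeBuilt k H s) {t : Finset W} (hts : t ⊆ s) (ht : t.Nonempty) :
    ∃ v ∈ t, ∀ n ⊆ t, (∀ w ∈ n, H.Adj v w) → n.card ≤ k := by
  classical
  induction h generalizing t with
  | base s hs =>
    obtain ⟨v, hv⟩ := ht
    refine ⟨v, hv, fun n hn hadj => ?_⟩
    have : insert v n ⊆ s := Finset.insert_subset (hts hv) (hn.trans hts)
    have h1 := Finset.card_le_card this
    rw [Finset.card_insert_of_notMem fun h => (hadj v h).ne rfl, hs.2] at h1
    omega
  | attach s v hv c hcs hc hadj hs ih =>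
    by_cases hvt : v ∈ t
    · refine ⟨v, hvt, fun n hn hna => ?_⟩
      rw [← hc.2]
      refine Finset.card_le_card fun w hw => ?_
      have hws := Finset.mem_cons.1 (hts (hn hw))
      rcases hws with rfl | hws
      · exact absurd rfl (hna _ hw).ne
      · exact (hadj w hws).1 (hna w hw)
    · refine ih (fun w hw => ?_) ht
      rcases Finset.mem_cons.1 (hts hw) with rfl | hws
      · exact absurd hw hvt
      · exact hws

/-- For `k ≤ N` all degrees are at least `k`, which contradicts `k'`-degeneracy on the image of the
graph if `k' < k`. -/
theorem le_of_isPartialKTree_bipartiteFin {k N k' : ℕ} (hk : 1 ≤ k) (hN : k ≤ N)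
    (h : IsPartialKTree k' (bipartiteFin k N)) : k ≤ k' := by
  classical
  obtain ⟨n, H, ⟨s, hs, hbuilt⟩, ⟨f, hf⟩⟩ := h
  have : NeZero (k + N) := ⟨by omega⟩
  obtain ⟨v, hv, hcard⟩ := hbuilt.exists_card_le (t := Finset.univ.image f) (fun v _ => hs v)
    (by simp [Finset.univ_nonempty])
  obtain ⟨i, -, rfl⟩ := Finset.mem_image.1 hv
  let M : Finset (Fin (k + N)) := if i.val < k then Finset.univ.map (Fin.natAddEmb k)
    else Finset.univ.map (Fin.castAddEmb N)
  have hM : k ≤ M.card := by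
    simp only [M]
    split_ifs <;> simp [hN]
  have := hcard (M.image f) (Finset.image_subset_image (Finset.subset_univ _)) ?_
  · rw [Finset.card_image_of_injective _ hf] at this
    omega
  · intro w hw
    obtain ⟨j, hj, rfl⟩ := Finset.mem_image.1 hw
    refine f.map_adj ?_
    rw [bipartiteFin_adj]
    simp only [M] at hj
    split_ifs at hj with hi
    · obtain ⟨a, -, rfl⟩ := Finset.mem_map.1 hj
      simp [hi]
    · obtain ⟨a, -, rfl⟩ := Finset.mem_map.1 hj
      simp
      omega

theorem treewidth_bipartiteFin {k N : ℕ} (hk : 1 ≤ k) (hN : k ≤ N) :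
    treewidth (bipartiteFin k N) = k := by
  refine le_antisymm ?_ ?_
  · exact iInf₂_le k (isPartialKTree_bipartiteFin (by omega))
  · refine le_iInf₂ fun k' hk' => ?_
    exact_mod_cast le_of_isPartialKTree_bipartiteFin hk hN hk'

theorem le_bendNumber_bipartiteFin {k N : ℕ}
    (hN : ((k * (2 * k - 2)) ^ 2 + 2 * k) * 4 < N) :
    ((2 * k - 2 : ℕ) : ℕ∞) ≤ bendNumber (bipartiteFin k N) :=
  le_iInf₂ fun _ hj => Nat.cast_le.2 (le_of_hasBendRepresentation_bipartiteFin hN hj)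

/-! ### Paths as lists of rational coordinates -/

section CoordinateLists

open Set Filter Topology

/-- The grid path of direction `d` with coordinate list `c₀, c₁, c₂, …` runs on the line `c₁` of
direction `d` from `c₀` to `c₂`, then on the line `c₂` of the other direction from `c₁` to `c₃`,
and so on. `Occ d c e l t` says that it passes the point `t` of the line `l` of direction `e` in
the interior of a segment. -/
def Occ : Bool → List ℚ → Bool → ℚ → ℚ → Prop
  | d, a :: b :: c :: l, e, ℓ, t =>
    (e = d ∧ ℓ = b ∧ t ∈ Ioo (min a c) (max a c)) ∨ Occ (!d) (b :: c :: l) e ℓ t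
  | _, _, _, _, _ => False

theorem occ_cons {d : Bool} {a b c : ℚ} {l : List ℚ} {e : Bool} {ℓ t : ℚ} :
    Occ d (a :: b :: c :: l) e ℓ t ↔
      (e = d ∧ ℓ = b ∧ t ∈ Ioo (min a c) (max a c)) ∨ Occ (!d) (b :: c :: l) e ℓ t := Iff.rfl

theorem not_occ_pair {d : Bool} {a b : ℚ} {e : Bool} {ℓ t : ℚ} : ¬ Occ d [a, b] e ℓ t :=
  fun h => h

theorem not_occ_singleton {d : Bool} {a : ℚ} {e : Bool} {ℓ t : ℚ} : ¬ Occ d [a] e ℓ t :=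
  fun h => h

theorem not_occ_nil {d : Bool} {e : Bool} {ℓ t : ℚ} : ¬ Occ d [] e ℓ t :=
  fun h => h

theorem Occ.mem {d : Bool} {c : List ℚ} {e : Bool} {ℓ t : ℚ} (h : Occ d c e ℓ t) : ℓ ∈ c := by
  induction c generalizing d with
  | nil => exact h.elim
  | cons a c ih =>
    match c with
    | [] => exact h.elim
    | [b] => exact h.elim
    | b :: c :: l =>
      rcases h with ⟨-, rfl, -⟩ | h
      · simp
      · exact List.mem_cons_of_mem _ (ih h)

/-- The entries at even positions. -/
def evens : List ℚ → List ℚ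
  | [] => []
  | [a] => [a]
  | a :: _ :: l => a :: evens l

/-- No two segments of a coordinate list lie on the same line, and no segment is degenerate. -/
def Good (c : List ℚ) : Prop := (evens c).Nodup ∧ (evens c.tail).Nodup

/-- `x₀, l₀, x₁, l₁, …` followed by `tl`. -/
def weave : List (ℚ × ℚ) → List ℚ → List ℚ
  | [], tl => tl
  | p :: r, tl => p.1 :: p.2 :: weave r tl

theorem evens_weave (r : List (ℚ × ℚ)) (tl : List ℚ) :
    evens (weave r tl) = r.map Prod.fst ++ evens tl := by
  induction r with
  | nil => rfl
  | cons p r ih => simp [weave, evens, ih]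

theorem evens_tail_weave (r : List (ℚ × ℚ)) (y : ℚ) (tl : List ℚ) :
    evens (weave r (y :: tl)).tail = r.map Prod.snd ++ evens tl := by
  induction r with
  | nil => rfl
  | cons p r ih =>
    cases r with
    | nil => simp [weave, evens]
    | cons p' r => simpa [weave, evens] using ih

theorem length_weave (r : List (ℚ × ℚ)) (tl : List ℚ) :
    (weave r tl).length = 2 * r.length + tl.length := by
  induction r with
  | nil => simp [weave]
  | cons p r ih => simp [weave, ih]; ring

/-- Each pair put in front adds two segments, so the direction of the tail is flipped twice and
stays the same. -/
theorem Occ.weave {d : Bool} {r : List (ℚ × ℚ)} {y : ℚ} {tl : List ℚ} {e : Bool} {ℓ t : ℚ}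
    (h : Occ d (y :: tl) e ℓ t) : Occ d (weave r (y :: tl)) e ℓ t := by
  induction r with
  | nil => exact h
  | cons p r ih =>
    cases r with
    | nil =>
      cases tl with
      | nil => exact h.elim
      | cons m tl =>
        refine Or.inr (Or.inr ?_)
        rwa [Bool.not_not]
    | cons p' r =>
      refine Or.inr (Or.inr ?_)
      rw [Bool.not_not]
      exact ih

theorem occ_weave_cases {d : Bool} {r : List (ℚ × ℚ)} {y : ℚ} {tl : List ℚ} {e : Bool} {ℓ t : ℚ}
    {a b : ℚ} (hr : ∀ p ∈ r, p.1 ∈ Icc a b) (hy : y ∈ Icc a b)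
    (h : Occ d (weave r (y :: tl)) e ℓ t) :
    (e = d ∧ ℓ ∈ r.map Prod.snd ∧ t ∈ Icc a b) ∨ (e = !d ∧ (ℓ ∈ r.map Prod.fst ∨ ℓ = y)) ∨
      Occ d (y :: tl) e ℓ t := by
  have key : ∀ x x', x ∈ Icc a b → x' ∈ Icc a b → t ∈ Ioo (min x x') (max x x') → t ∈ Icc a b :=
    fun x x' hx hx' ht => ⟨(le_min hx.1 hx'.1).trans ht.1.le, ht.2.le.trans (max_le hx.2 hx'.2)⟩
  induction r with
  | nil => exact Or.inr (Or.inr h)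
  | cons p r ih =>
    have hp := hr p (by simp)
    cases r with
    | nil =>
      rcases h with ⟨rfl, rfl, h⟩ | h
      · exact Or.inl ⟨rfl, by simp, key _ _ hp hy h⟩
      · cases tl with
        | nil => exact h.elim
        | cons m tl =>
          rcases h with ⟨rfl, rfl, h⟩ | h
          · exact Or.inr (Or.inl ⟨rfl, Or.inr rfl⟩)
          · rw [Bool.not_not] at h
            exact Or.inr (Or.inr h)
    | cons p' r =>
      rcases h with ⟨rfl, rfl, h⟩ | ⟨rfl, rfl, h⟩ | h
      · exact Or.inl ⟨rfl, by simp, key _ _ hp (hr p' (by simp)) h⟩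
      · exact Or.inr (Or.inl ⟨rfl, Or.inl (by simp)⟩)
      · rw [Bool.not_not] at h
        rcases ih (fun q hq => hr q (List.mem_cons_of_mem _ hq)) h with ⟨h1, h2, h3⟩ | ⟨h1, h2⟩ | h
        · exact Or.inl ⟨h1, List.mem_cons_of_mem _ h2, h3⟩
        · exact Or.inr (Or.inl ⟨h1, h2.imp_left (List.mem_cons_of_mem _)⟩)
        · exact Or.inr (Or.inr h)

theorem exists_occ_weave {d : Bool} {r : List (ℚ × ℚ)} {y : ℚ} {tl : List ℚ} {a b : ℚ}
    (hr : ∀ p ∈ r, p.1 ∈ Ioo a b) (hy : y ∈ Ioo a b) (hnd : (r.map Prod.fst ++ [y]).Nodup)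
    {l : ℚ} (hl : l ∈ r.map Prod.snd) :
    ∃ c c', a < c ∧ c < c' ∧ c' < b ∧ ∀ t ∈ Ioo c c', Occ d (weave r (y :: tl)) d l t := by
  have key : ∀ x x', x ∈ Ioo a b → x' ∈ Ioo a b → x ≠ x' →
      a < min x x' ∧ min x x' < max x x' ∧ max x x' < b :=
    fun x x' hx hx' hne => ⟨lt_min hx.1 hx'.1, min_lt_max.2 hne, max_lt hx.2 hx'.2⟩
  induction r with
  | nil => simp at hl
  | cons p r ih =>
    have hp := hr p (by simp)
    cases r with
    | nil =>
      obtain rfl : l = p.2 := by simpa using hl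
      have hne : p.1 ≠ y := by simpa using hnd
      obtain ⟨h1, h2, h3⟩ := key _ _ hp hy hne
      exact ⟨_, _, h1, h2, h3, fun t ht => Or.inl ⟨rfl, rfl, ht⟩⟩
    | cons p' r =>
      rw [List.map_cons, List.mem_cons] at hl
      rcases hl with rfl | hl
      · have hne : p.1 ≠ p'.1 := fun h => by simp [h] at hnd
        obtain ⟨h1, h2, h3⟩ := key _ _ hp (hr p' (by simp)) hne
        exact ⟨_, _, h1, h2, h3, fun t ht => Or.inl ⟨rfl, rfl, ht⟩⟩
      · obtain ⟨c, c', h1, h2, h3, h4⟩ := ih (fun q hq => hr q (List.mem_cons_of_mem _ hq))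
          (by rw [List.map_cons, List.cons_append] at hnd; exact hnd.of_cons) hl
        refine ⟨c, c', h1, h2, h3, fun t ht => Or.inr (Or.inr ?_)⟩
        rw [Bool.not_not]
        exact h4 t ht

/-! ### The two shapes of new paths -/

theorem exists_fresh (F : Finset ℚ) {a b : ℚ} (h : a < b) (n : ℕ) :
    ∃ xs : List ℚ, xs.length = n ∧ xs.Nodup ∧ ∀ x ∈ xs, x ∈ Ioo a b ∧ x ∉ F := by
  obtain ⟨t, ht, hcard⟩ :=
    ((Ioo_infinite h).sdiff F.finite_toSet).exists_subset_card_eq n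
  refine ⟨t.toList, by simp [hcard], t.nodup_toList, fun x hx => ?_⟩
  have := ht (Finset.mem_coe.2 (Finset.mem_toList.1 hx))
  exact ⟨this.1, fun h => this.2 (Finset.mem_coe.2 h)⟩

theorem exists_zip (F : Finset ℚ) {a b : ℚ} (h : a < b) (ls : List ℚ) :
    ∃ (r : List (ℚ × ℚ)) (y : ℚ), r.map Prod.snd = ls ∧ (r.map Prod.fst ++ [y]).Nodup ∧
      (∀ p ∈ r, p.1 ∈ Ioo a b ∧ p.1 ∉ F) ∧ y ∈ Ioo a b ∧ y ∉ F := by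
  obtain ⟨xs, hlen, hnd, hx⟩ := exists_fresh F h (ls.length + 1)
  match xs with
  | [] => simp at hlen
  | y :: xs =>
    have hlen : xs.length = ls.length := by simpa using hlen
    have h1 : (xs.zip ls).map Prod.fst = xs := List.map_fst_zip hlen.le
    refine ⟨xs.zip ls, y, List.map_snd_zip hlen.ge, ?_, ?_, hx y (by simp)⟩
    · rw [h1, List.nodup_append_comm]
      exact hnd
    · intro p hp
      have : p.1 ∈ xs := h1 ▸ List.mem_map_of_mem hp
      exact hx _ (List.mem_cons_of_mem _ this)

/-- Taking `y` beyond everything on the side of `q` away from `l` makes the segment between `y` and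
`l` pass just to the right of `q`. This requires the smaller end to be at most `q` and the larger
one to exceed it, whence the asymmetric inequalities. -/
theorem exists_extreme (F : Finset ℚ) (q l : ℚ) :
    ∃ y, y ∉ F ∧ y ≠ l ∧ ((l ≤ q ∧ q < y) ∨ (y < q ∧ q < l)) := by
  have hfin : (insert q (insert l F) : Finset ℚ).Nonempty := ⟨q, by simp⟩
  rcases le_or_gt l q with h | h
  · obtain ⟨y, hy⟩ := exists_gt ((insert q (insert l F)).max' hfin)
    have hlt : ∀ f ∈ insert q (insert l F), f < y := fun f hf => (Finset.le_max' _ f hf).trans_lt hy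
    exact ⟨y, fun hF => (hlt y (by simp [hF])).false, (hlt l (by simp)).ne',
      Or.inl ⟨h, hlt q (by simp)⟩⟩
  · obtain ⟨y, hy⟩ := exists_lt ((insert q (insert l F)).min' hfin)
    have hlt : ∀ f ∈ insert q (insert l F), y < f := fun f hf => hy.trans_le (Finset.min'_le _ f hf)
    exact ⟨y, fun hF => (hlt y (by simp [hF])).false, (hlt l (by simp)).ne,
      Or.inr ⟨hlt q (by simp), h⟩⟩

/-- A coordinate list that touches the lines `ls` between `a₁` and `b₁`, and the line `l` between
`a₂` and `b₂`, and that passes the point `p` on a new line of direction `d` and the point `q` on a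
new line of the other direction. -/
theorem exists_crossing_path (F : Finset ℚ) (d : Bool) {ls : List ℚ} (hls : ls.Nodup)
    (hF : ∀ l ∈ ls, l ∈ F) {l : ℚ} (hl : l ∉ ls) {a₁ b₁ a₂ b₂ : ℚ} (h₁ : a₁ < b₁) (h₂ : a₂ < b₂)
    {p : ℚ} (hp : (b₁ ≤ p ∧ p < a₂) ∨ (b₂ ≤ p ∧ p < a₁)) (q : ℚ) :
    ∃ (c : List ℚ) (y x : ℚ), Good c ∧ c.length = 2 * ls.length + 5 ∧ y ∉ F ∧ x ∉ F ∧
      (∀ m ∈ ls, ∃ t ∈ Icc a₁ b₁, Occ d c d m t) ∧ (∃ t ∈ Icc a₂ b₂, Occ d c d l t) ∧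
      (∀ᶠ t in 𝓝[>] p, Occ d c d y t) ∧ (∀ᶠ t in 𝓝[>] q, Occ d c (!d) x t) ∧
      (∀ e m t, Occ d c e m t → (e = d ∧ m ∈ ls ∧ t ∈ Icc a₁ b₁) ∨
        (e = d ∧ m = l ∧ t ∈ Icc a₂ b₂) ∨ m ∉ F) := by
  obtain ⟨r, x₁, hr, hnd, hrx, hx₁, hx₁F⟩ := exists_zip F h₁ ls
  obtain ⟨xs, hlen, hxnd, hxs⟩ := exists_fresh (F ∪ (x₁ :: r.map Prod.fst).toFinset) h₂ 2
  obtain ⟨x, x', rfl⟩ := List.length_eq_two.1 hlen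
  obtain ⟨hx, hxF⟩ := hxs x (by simp)
  obtain ⟨hx', hxF'⟩ := hxs x' (by simp)
  simp only [Finset.mem_union, List.mem_toFinset, List.mem_cons, not_or] at hxF hxF'
  have hxx : x ≠ x' := by simpa using hxnd
  obtain ⟨y, hyF, hyl, hy⟩ := exists_extreme F q l
  -- After the touches near `x₁`, three segments follow: on the new line `y` across `p`, on the new
  -- perpendicular line `x` across `q`, and on `l` between `a₂` and `b₂`.
  have htail : ∀ e m t, Occ d [x₁, y, x, l, x'] e m t ↔
      (e = d ∧ m = y ∧ t ∈ Ioo (min x₁ x) (max x₁ x)) ∨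
      (e = (!d) ∧ m = x ∧ t ∈ Ioo (min y l) (max y l)) ∨
      (e = d ∧ m = l ∧ t ∈ Ioo (min x x') (max x x')) := by
    intro e m t
    simp only [occ_cons, not_occ_pair, or_false, Bool.not_not]
  refine ⟨weave r [x₁, y, x, l, x'], y, x, ⟨?_, ?_⟩, ?_, hyF, hxF.1, ?_, ?_, ?_, ?_, ?_⟩
  · have : r.map Prod.fst ++ evens [x₁, y, x, l, x'] = (r.map Prod.fst ++ [x₁]) ++ [x, x'] := by
      simp [evens]
    rw [evens_weave, this, List.nodup_append']
    refine ⟨hnd, hxnd, ?_⟩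
    rw [List.disjoint_right]
    simp only [List.mem_cons, List.not_mem_nil, or_false, forall_eq_or_imp, forall_eq,
      List.mem_append, not_or]
    tauto
  · rw [evens_tail_weave, hr]
    simp only [evens, List.nodup_append', List.nodup_cons, hls, hyl,
      List.disjoint_right, List.mem_cons, List.not_mem_nil, or_false, forall_eq_or_imp, forall_eq,
      hl, not_false_eq_true, List.nodup_nil, and_true, true_and]
    exact fun h => hyF (hF y h)
  · have : r.length = ls.length := by rw [← hr, List.length_map]
    rw [length_weave, this]
    rfl
  · intro m hm
    obtain ⟨c, c', hc, hcc, hc', h⟩ := exists_occ_weave (d := d) (tl := [y, x, l, x'])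
      (fun p hp => (hrx p hp).1) hx₁ hnd (hr ▸ hm)
    obtain ⟨t, ht⟩ := exists_between hcc
    exact ⟨t, ⟨(hc.trans ht.1).le, (ht.2.trans hc').le⟩, h t ht⟩
  · obtain ⟨t, ht⟩ := exists_between (min_lt_max.2 hxx)
    refine ⟨t, ⟨(le_min hx.1.le hx'.1.le).trans ht.1.le, ht.2.le.trans (max_le hx.2.le hx'.2.le)⟩,
      Occ.weave ((htail _ _ _).2 (Or.inr (Or.inr ⟨rfl, rfl, ht⟩)))⟩
  · have : p < max x₁ x ∧ min x₁ x ≤ p := by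
      rcases hp with ⟨hp, hp'⟩ | ⟨hp, hp'⟩
      · exact ⟨lt_max_of_lt_right (hp'.trans hx.1), min_le_of_left_le (hx₁.2.le.trans hp)⟩
      · exact ⟨lt_max_of_lt_left (hp'.trans hx₁.1), min_le_of_right_le (hx.2.le.trans hp)⟩
    filter_upwards [Ioo_mem_nhdsGT this.1] with t ht
    exact Occ.weave ((htail _ _ _).2 (Or.inl ⟨rfl, rfl, this.2.trans_lt ht.1, ht.2⟩))
  · have : q < max y l ∧ min y l ≤ q := by
      rcases hy with ⟨hy, hy'⟩ | ⟨hy, hy'⟩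
      · exact ⟨lt_max_of_lt_left hy', min_le_of_right_le hy⟩
      · exact ⟨lt_max_of_lt_right hy', min_le_of_left_le hy.le⟩
    filter_upwards [Ioo_mem_nhdsGT this.1] with t ht
    exact Occ.weave ((htail _ _ _).2 (Or.inr (Or.inl ⟨rfl, rfl, this.2.trans_lt ht.1, ht.2⟩)))
  · intro e m t h
    rcases occ_weave_cases (fun p hp => Ioo_subset_Icc_self (hrx p hp).1)
      (Ioo_subset_Icc_self hx₁) h with ⟨h1, h2, h3⟩ | ⟨h1, h2⟩ | h
    · exact Or.inl ⟨h1, hr ▸ h2, h3⟩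
    · refine Or.inr (Or.inr ?_)
      rcases h2 with h2 | rfl
      · obtain ⟨p, hp, rfl⟩ := List.mem_map.1 h2
        exact (hrx p hp).2
      · exact hx₁F
    · rcases (htail _ _ _).1 h with ⟨-, rfl, -⟩ | ⟨-, rfl, -⟩ | ⟨rfl, rfl, ht⟩
      · exact Or.inr (Or.inr hyF)
      · exact Or.inr (Or.inr hxF.1)
      · exact Or.inr (Or.inl ⟨rfl, rfl, (le_min hx.1.le hx'.1.le).trans ht.1.le,
          ht.2.le.trans (max_le hx.2.le hx'.2.le)⟩)

/-- A zigzag that touches the lines `ls` between `a` and `b`. -/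
theorem exists_zigzag_path (F : Finset ℚ) (d : Bool) {ls : List ℚ} (hls : ls.Nodup)
    (hlen : 2 ≤ ls.length) {a b : ℚ} (h : a < b) :
    ∃ (c : List ℚ) (x q : ℚ), Good c ∧ c.length = 2 * ls.length + 1 ∧ x ∉ F ∧
      (∀ m ∈ ls, ∃ e ∈ Ioo a b, ∀ᶠ t in 𝓝[>] e, Occ d c d m t) ∧
      (∀ᶠ t in 𝓝[>] q, Occ d c (!d) x t) ∧
      (∀ e m t, Occ d c e m t → (e = d ∧ m ∈ ls ∧ t ∈ Icc a b) ∨ m ∉ F) := by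
  obtain ⟨r, y, hr, hnd, hrx, hy, hyF⟩ := exists_zip F h ls
  have hrlen : r.length = ls.length := by rw [← hr, List.length_map]
  obtain ⟨p, p', r, rfl⟩ : ∃ p p' r', r = p :: p' :: r' := by
    match r with
    | [] => simp at hrlen; omega
    | [p] => simp at hrlen; omega
    | p :: p' :: r' => exact ⟨p, p', r', rfl⟩
  have hne : p.2 ≠ p'.2 := by
    rw [← hr] at hls
    intro h
    simp [h] at hls
  -- The witness is the first perpendicular segment, which connects the first two touched lines;
  -- this is why two lines are needed.
  refine ⟨weave (p :: p' :: r) [y], p'.1, min p.2 p'.2, ⟨?_, ?_⟩, ?_,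
    (hrx p' (by simp)).2, ?_, ?_, ?_⟩
  · rwa [evens_weave]
  · rw [evens_tail_weave, hr]
    simpa [evens] using hls
  · rw [length_weave, hrlen]
    rfl
  · intro m hm
    obtain ⟨c, c', hc, hcc, hc', h⟩ := exists_occ_weave (d := d) (tl := [])
      (fun p hp => (hrx p hp).1) hy hnd (hr ▸ hm)
    exact ⟨c, ⟨hc, hcc.trans hc'⟩, by filter_upwards [Ioo_mem_nhdsGT hcc] with t ht using h t ht⟩
  · filter_upwards [Ioo_mem_nhdsGT (min_lt_max.2 hne)] with t ht
    cases r <;> exact Or.inr (Or.inl ⟨rfl, rfl, ht⟩)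
  · intro e m t h
    rcases occ_weave_cases (fun p hp => Ioo_subset_Icc_self (hrx p hp).1)
      (Ioo_subset_Icc_self hy) h with ⟨h1, h2, h3⟩ | ⟨h1, h2⟩ | h
    · exact Or.inl ⟨h1, hr ▸ h2, h3⟩
    · refine Or.inr ?_
      rcases h2 with h2 | rfl
      · obtain ⟨p, hp, rfl⟩ := List.mem_map.1 h2
        exact (hrx p hp).2
      · exact hyF
    · exact h.elim

/-! ### Germs and clique configurations -/

section Configurations

variable {W : Type*}

/-- To the right of `p`, the line `l` of direction `d` is used exactly by the vertices in `S`. -/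
def LineGerm (O : W → Bool → ℚ → ℚ → Prop) (F : Finset ℚ) (d : Bool) (l p : ℚ) (S : Set W) : Prop :=
  l ∈ F ∧ p ∈ F ∧ ∀ᶠ t in 𝓝[>] p, ∀ w, O w d l t ↔ w ∈ S

/-- To the right of `p`, each vertex of `C` has a line of direction `d` of its own. -/
def Faces (O : W → Bool → ℚ → ℚ → Prop) (F : Finset ℚ) (d : Bool) (C : Set W) (L : W → ℚ)
    (p : ℚ) : Prop :=
  InjOn L C ∧ ∀ v ∈ C, LineGerm O F d (L v) p {v}

/-- The configurations of cliques that allow to attach a further vertex. Either all members face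
each other, or all members but `z` face each other in direction `d`, all members outside `R` face
each other in the other direction, and `z` runs together with each member of `R` somewhere. -/
def Conf (O : W → Bool → ℚ → ℚ → Prop) (F : Finset ℚ) (C : Set W) : Prop :=
  ∃ d, (∃ L p, Faces O F d C L p) ∨
    ∃ z R L M p q, z ∈ C ∧ z ∉ R ∧ R ⊆ C ∧ Faces O F d (C \ {z}) L p ∧
      Faces O F (!d) (C \ R) M q ∧ ∀ v ∈ R, ∃ c, LineGerm O F d (L v) c {z, v}

variable {O : W → Bool → ℚ → ℚ → Prop} {F F' : Finset ℚ} {d : Bool} {C C' : Set W} {L : W → ℚ}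
  {p : ℚ}

theorem LineGerm.mono {l : ℚ} {S : Set W} (h : LineGerm O F d l p S) (hF : F ⊆ F') :
    LineGerm O F' d l p S :=
  ⟨hF h.1, hF h.2.1, h.2.2⟩

theorem Faces.mono (h : Faces O F d C L p) (hF : F ⊆ F') : Faces O F' d C L p :=
  ⟨h.1, fun v hv => (h.2 v hv).mono hF⟩

theorem Faces.subset (h : Faces O F d C L p) (hC : C' ⊆ C) : Faces O F d C' L p :=
  ⟨h.1.mono hC, fun v hv => h.2 v (hC hv)⟩

/-- Once the exceptional vertex `z` is dropped, the remaining members face each other in direction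
`d`. -/
theorem Conf.subset (h : Conf O F C) (hC : C' ⊆ C) : Conf O F C' := by
  obtain ⟨d, ⟨L, p, h⟩ | ⟨z, R, L, M, p, q, hz, hzR, hRC, h1, h2, h3⟩⟩ := h
  · exact ⟨d, Or.inl ⟨L, p, h.subset hC⟩⟩
  · by_cases hz' : z ∈ C'
    · refine ⟨d, Or.inr ⟨z, R ∩ C', L, M, p, q, hz', fun h => hzR h.1, inter_subset_right,
        h1.subset (sdiff_subset_sdiff_left hC), h2.subset ?_, fun v hv => h3 v hv.1⟩⟩
      exact fun v hv => ⟨hC hv.1, fun hR => hv.2 ⟨hR, hv.1⟩⟩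
    · exact ⟨d, Or.inl ⟨L, p, h1.subset fun v hv => ⟨hC hv, fun h => hz' (h ▸ hv)⟩⟩⟩

theorem eventually_notMem (F : Finset ℚ) (p : ℚ) : ∀ᶠ t in 𝓝[>] p, t ∉ F := by
  have h : ((F.erase p : Finset ℚ) : Set ℚ)ᶜ ∈ 𝓝 p :=
    (F.erase p).finite_toSet.isClosed.isOpen_compl.mem_nhds (by simp)
  filter_upwards [mem_nhdsWithin_of_mem_nhds h, self_mem_nhdsWithin] with t ht htp hF
  exact ht (by simpa using ⟨hF, (mem_Ioi.1 htp).ne'⟩)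

theorem exists_Ioo_of_eventually {Q : ℚ → Prop} (h : ∀ᶠ t in 𝓝[>] p, Q t) (F : Finset ℚ) :
    ∃ b, p < b ∧ (∀ f ∈ F, f ∉ Ioo p b) ∧ ∀ t ∈ Ioo p b, Q t := by
  obtain ⟨b, hb, hsub⟩ := mem_nhdsGT_iff_exists_Ioo_subset.1 (h.and (eventually_notMem F p))
  exact ⟨b, hb, fun f hf hfb => (hsub hfb).2 hf, fun t ht => (hsub ht).1⟩

theorem eventually_notMem_Icc {F : Finset ℚ} {a b : ℚ} (h : ∀ f ∈ F, f ∉ Icc a b) (hp : p ∈ F) :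
    ∀ᶠ t in 𝓝[>] p, t ∉ Icc a b :=
  mem_nhdsWithin_of_mem_nhds (isClosed_Icc.isOpen_compl.mem_nhds (h p hp))

/-- The coordinate list `c` is short, meets exactly the vertices of `N`, and can be added without
destroying any germ. -/
structure Fits (O : W → Bool → ℚ → ℚ → Prop) (F : Finset ℚ) (k : ℕ) (N : Set W) (d : Bool)
    (c : List ℚ) : Prop where
  good : Good c
  length_le : c.length ≤ 2 * k + 1
  meets : ∀ w, (∃ e m t, Occ d c e m t ∧ O w e m t) ↔ w ∈ N
  stable : ∀ e, ∀ m ∈ F, ∀ p ∈ F, ∀ᶠ t in 𝓝[>] p, ¬ Occ d c e m t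

/-- All used lines outside the two intervals are new, so nobody else is met there; the intervals are
closed and avoid `F`, so they stay away from a right neighbourhood of every point of `F`. The length
is `2 * ts.card + 5`, which explains `ts.card + 2 ≤ k`. -/
theorem exists_fits_of_intervals [DecidableEq W] (hO : ∀ w e m t, O w e m t → m ∈ F) {k : ℕ}
    (d : Bool) {ts : Finset W} (hts : ts.card + 2 ≤ k) (hL : InjOn L ts) {l : ℚ}
    (hl : l ∉ ts.image L) {S : Set W} {a₁ b₁ a₂ b₂ : ℚ} (h₁ : a₁ < b₁) (h₂ : a₂ < b₂)
    (hF₁ : ∀ f ∈ F, f ∉ Icc a₁ b₁) (hF₂ : ∀ f ∈ F, f ∉ Icc a₂ b₂)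
    (hO₁ : ∀ v ∈ ts, L v ∈ F ∧ ∀ t ∈ Icc a₁ b₁, ∀ w, O w d (L v) t ↔ w = v)
    (hO₂ : ∀ t ∈ Icc a₂ b₂, ∀ w, O w d l t ↔ w ∈ S)
    (hp : (b₁ ≤ p ∧ p < a₂) ∨ (b₂ ≤ p ∧ p < a₁)) (q : ℚ) :
    ∃ c y x, Fits O F k (ts ∪ S) d c ∧ y ∉ F ∧ x ∉ F ∧
      (∀ᶠ t in 𝓝[>] p, Occ d c d y t) ∧ (∀ᶠ t in 𝓝[>] q, Occ d c (!d) x t) := by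
  obtain ⟨c, y, x, hgood, hlen, hy, hx, ho₁, ho₂, hyp, hxq, hocc⟩ :=
    exists_crossing_path F d (ls := (ts.image L).toList) (Finset.nodup_toList _)
      (by simpa using fun v hv => (hO₁ v hv).1) (l := l) (by simpa using hl) h₁ h₂ hp q
  refine ⟨c, y, x, ⟨hgood, ?_, ?_, ?_⟩, hy, hx, hyp, hxq⟩
  · rw [hlen, Finset.length_toList, Finset.card_image_of_injOn hL]
    omega
  · intro w
    constructor
    · rintro ⟨e, m, t, h, hw⟩
      rcases hocc e m t h with ⟨rfl, hm, ht⟩ | ⟨rfl, rfl, ht⟩ | hm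
      · obtain ⟨v, hv, rfl⟩ := Finset.mem_image.1 (Finset.mem_toList.1 hm)
        obtain rfl := ((hO₁ v hv).2 t ht w).1 hw
        exact Or.inl hv
      · exact Or.inr ((hO₂ t ht w).1 hw)
      · exact absurd (hO _ _ _ _ hw) hm
    · rintro (hw | hw)
      · obtain ⟨t, ht, h⟩ := ho₁ (L w) (Finset.mem_toList.2 (Finset.mem_image_of_mem _ hw))
        exact ⟨_, _, _, h, ((hO₁ w hw).2 t ht w).2 rfl⟩
      · obtain ⟨t, ht, h⟩ := ho₂
        exact ⟨_, _, _, h, (hO₂ t ht w).2 hw⟩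
  · intro e m hm p hp
    filter_upwards [eventually_notMem_Icc hF₁ hp, eventually_notMem_Icc hF₂ hp] with t ht₁ ht₂ h
    rcases hocc e m t h with ⟨-, -, h⟩ | ⟨-, -, h⟩ | h
    · exact ht₁ h
    · exact ht₂ h
    · exact h hm

/-- The point of facing may be moved to the right, which makes room for touches on its left. -/
theorem Faces.of_mem_Ioo {b : ℚ} (h : Faces O F d C L p)
    (hb : ∀ t ∈ Ioo p b, ∀ v ∈ C, ∀ w, O w d (L v) t ↔ w = v) {p' : ℚ} (hp' : p' ∈ Ioo p b) :
    Faces O (insert p' F) d C L p' := by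
  refine ⟨h.1, fun v hv => ⟨Finset.mem_insert_of_mem (h.2 v hv).1, Finset.mem_insert_self _ _, ?_⟩⟩
  filter_upwards [Ioo_mem_nhdsGT hp'.2] with t ht w
  exact hb t ⟨hp'.1.trans ht.1, ht.2⟩ v hv w

variable [Finite W]

theorem Faces.exists_Ioo (h : Faces O F d C L p) :
    ∃ b, p < b ∧ (∀ f ∈ F, f ∉ Ioo p b) ∧
      ∀ t ∈ Ioo p b, ∀ v ∈ C, ∀ w, O w d (L v) t ↔ w = v := by
  refine exists_Ioo_of_eventually ?_ F
  rw [eventually_all]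
  intro v
  by_cases hv : v ∈ C
  · filter_upwards [(h.2 v hv).2.2] with t ht _ w using ht w
  · exact Eventually.of_forall fun t h => absurd h hv

/-- A fitting coordinate list whose vertex faces the vertices in `C` on a new line of direction
`d`, and that passes `q` on a new line of the other direction. -/
def ExistsCrossing (O : W → Bool → ℚ → ℚ → Prop) (F : Finset ℚ) (k : ℕ) (N : Set W) (d : Bool)
    (C : Set W) (L : W → ℚ) (q : ℚ) : Prop :=
  ∃ F₁ ⊇ F, ∃ p c y x, Fits O F₁ k N d c ∧ Faces O F₁ d C L p ∧ y ∉ F₁ ∧ x ∉ F₁ ∧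
    (∀ᶠ t in 𝓝[>] p, Occ d c d y t) ∧ (∀ᶠ t in 𝓝[>] q, Occ d c (!d) x t)

theorem Faces.existsCrossing [DecidableEq W] (h : Faces O F d C L p)
    (hO : ∀ w e m t, O w e m t → m ∈ F) {k : ℕ} (hk : 2 ≤ k) {N : Finset W} (hN : ↑N ⊆ C)
    (hcard : N.card + 1 ≤ k) (q : ℚ) : ExistsCrossing O F k N d C L q := by
  obtain ⟨b, hpb, hbF, hb⟩ := h.exists_Ioo
  obtain ⟨p', hp'⟩ := exists_between hpb
  obtain ⟨a₁, ha₁⟩ := exists_between hp'.1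
  obtain ⟨b₁, hb₁⟩ := exists_between ha₁.2
  obtain ⟨a₂, ha₂⟩ := exists_between hp'.2
  obtain ⟨b₂, hb₂⟩ := exists_between ha₂.2
  have hsub₁ : Icc a₁ b₁ ⊆ Ioo p b := fun t ht =>
    ⟨ha₁.1.trans_le ht.1, ht.2.trans_lt (hb₁.2.trans hp'.2)⟩
  have hsub₂ : Icc a₂ b₂ ⊆ Ioo p b := fun t ht =>
    ⟨(hp'.1.trans ha₂.1).trans_le ht.1, ht.2.trans_lt hb₂.2⟩
  have hF₁ : ∀ f ∈ insert p' F, f ∉ Icc a₁ b₁ := by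
    intro f hf hfI
    rcases Finset.mem_insert.1 hf with rfl | hf
    · exact (hfI.2.trans_lt hb₁.2).false
    · exact hbF f hf (hsub₁ hfI)
  have hF₂ : ∀ f ∈ insert p' F, f ∉ Icc a₂ b₂ := by
    intro f hf hfI
    rcases Finset.mem_insert.1 hf with rfl | hf
    · exact (ha₂.1.trans_le hfI.1).false
    · exact hbF f hf (hsub₂ hfI)
  have hO' : ∀ w e m t, O w e m t → m ∈ insert p' F := fun w e m t h =>
    Finset.mem_insert_of_mem (hO w e m t h)
  refine ⟨insert p' F, Finset.subset_insert _ _, p', ?_⟩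
  rcases N.eq_empty_or_nonempty with rfl | ⟨v, hv⟩
  -- Without neighbours the final touch is on a line used by nobody.
  · obtain ⟨l, hl⟩ := Infinite.exists_notMem_finset (insert p' F)
    obtain ⟨c, y, x, hfit, hrest⟩ := exists_fits_of_intervals hO' d (ts := ∅) (L := L) (k := k)
      (by simpa) (by simp) (l := l) (by simp) (S := ∅) hb₁.1 hb₂.1 hF₁ hF₂ (by simp)
      (fun t _ w => ⟨fun h => absurd (hO' _ _ _ _ h) hl, fun h => h.elim⟩)
      (Or.inl ⟨hb₁.2.le, ha₂.1⟩) q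
    exact ⟨c, y, x, by simpa using hfit, h.of_mem_Ioo hb hp', hrest⟩
  · obtain ⟨c, y, x, hfit, hrest⟩ := exists_fits_of_intervals hO' d (ts := N.erase v) (L := L)
      (k := k) (by rw [Finset.card_erase_of_mem hv]; have := Finset.card_pos.2 ⟨v, hv⟩; omega)
      (h.1.mono fun w hw => hN (Finset.mem_of_mem_erase hw)) (l := L v)
      (by
        rw [Finset.mem_image]
        rintro ⟨w, hw, hwv⟩
        exact Finset.ne_of_mem_erase hw (h.1 (hN (Finset.mem_of_mem_erase hw)) (hN hv) hwv))
      (S := {v}) hb₁.1 hb₂.1 hF₁ hF₂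
      (fun w hw => ⟨Finset.mem_insert_of_mem (h.2 w (hN (Finset.mem_of_mem_erase hw))).1,
        fun t ht => hb t (hsub₁ ht) w (hN (Finset.mem_of_mem_erase hw))⟩)
      (fun t ht => hb t (hsub₂ ht) v (hN hv))
      (Or.inl ⟨hb₁.2.le, ha₂.1⟩) q
    refine ⟨c, y, x, ?_, h.of_mem_Ioo hb hp', hrest⟩
    have : ((N.erase v : Finset W) : Set W) ∪ {v} = N := by
      rw [Finset.coe_erase, sdiff_union_self, union_eq_left, singleton_subset_iff]
      exact hv
    rwa [this] at hfit

/-- One touch at the germ shared by `z` and `v` serves both, so `k` neighbours are affordable here,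
one more than in `Faces.existsCrossing`. The other neighbours are touched near `p`, and the new line
crosses a facing point between the two places. -/
theorem Faces.existsCrossing_of_germ [DecidableEq W] {z v : W} (h : Faces O F d (C \ {z}) L p)
    (hO : ∀ w e m t, O w e m t → m ∈ F) {k : ℕ} {N : Finset W} (hN : ↑N ⊆ C)
    (hcard : N.card ≤ k) (hz : z ∈ N) (hv : v ∈ N) (hvz : v ≠ z) {c₀ : ℚ}
    (hc : LineGerm O F d (L v) c₀ {z, v}) (q : ℚ) : ExistsCrossing O F k N d (C \ {z}) L q := by
  obtain ⟨b, hpb, hbF, hb⟩ := h.exists_Ioo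
  obtain ⟨b', hpb', hbF', hb'⟩ := exists_Ioo_of_eventually hc.2.2 F
  have hvC : v ∈ C \ {z} := ⟨hN hv, hvz⟩
  obtain ⟨p', hp'⟩ := exists_between hpb
  obtain ⟨a₂, ha₂⟩ := exists_between hpb'
  obtain ⟨b₂, hb₂⟩ := exists_between ha₂.2
  have hsub₂ : Icc a₂ b₂ ⊆ Ioo c₀ b' := fun t ht => ⟨ha₂.1.trans_le ht.1, ht.2.trans_lt hb₂.2⟩
  have hpF : p ∈ F := (h.2 v hvC).2.1
  -- Just to the right of `p` the line `L v` belongs to `v` alone, just to the right of `c₀` to `z`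
  -- as well.
  have hne : c₀ ≠ p := by
    rintro rfl
    obtain ⟨t, ht⟩ := exists_between (lt_min hpb hpb')
    have h1 := hb t ⟨ht.1, ht.2.trans_le (min_le_left _ _)⟩ v hvC z
    have h2 := hb' t ⟨ht.1, ht.2.trans_le (min_le_right _ _)⟩ z
    exact hvz (h1.1 (h2.2 (by simp))).symm
  have hO' : ∀ w e m t, O w e m t → m ∈ insert p' F := fun w e m t h =>
    Finset.mem_insert_of_mem (hO w e m t h)
  have key : ∀ a₁ b₁ p₁, a₁ < b₁ → Icc a₁ b₁ ⊆ Ioo p b → p' ∉ Icc a₁ b₁ → p' ∉ Ioo c₀ b' →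
      ((b₁ ≤ p₁ ∧ p₁ < a₂) ∨ (b₂ ≤ p₁ ∧ p₁ < a₁)) → Faces O (insert p' F) d (C \ {z}) L p₁ →
      ExistsCrossing O F k N d (C \ {z}) L q := by
    intro a₁ b₁ p₁ hab hsub₁ hpa hpc hpos hfaces
    have hmem : ∀ w ∈ (N.erase z).erase v, w ∈ C \ {z} := fun w hw =>
      ⟨hN (Finset.mem_of_mem_erase (Finset.mem_of_mem_erase hw)),
        Finset.ne_of_mem_erase (Finset.mem_of_mem_erase hw)⟩
    have hvz' : v ∈ N.erase z := Finset.mem_erase.2 ⟨hvz, hv⟩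
    obtain ⟨c, y, x, hfit, hrest⟩ := exists_fits_of_intervals hO' d (ts := (N.erase z).erase v)
      (L := L) (k := k) (by
        have h1 := Finset.card_erase_add_one hvz'
        have h2 := Finset.card_erase_add_one hz
        omega)
      (h.1.mono hmem) (l := L v)
      (by
        rw [Finset.mem_image]
        rintro ⟨w, hw, hwv⟩
        exact Finset.ne_of_mem_erase hw (h.1 (hmem w hw) hvC hwv))
      (S := {z, v}) hab hb₂.1
      (by
        intro f hf hfI
        rcases Finset.mem_insert.1 hf with rfl | hf
        · exact hpa hfI
        · exact hbF f hf (hsub₁ hfI))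
      (by
        intro f hf hfI
        rcases Finset.mem_insert.1 hf with rfl | hf
        · exact hpc (hsub₂ hfI)
        · exact hbF' f hf (hsub₂ hfI))
      (fun w hw => ⟨Finset.mem_insert_of_mem (h.2 w (hmem w hw)).1,
        fun t ht => hb t (hsub₁ ht) w (hmem w hw)⟩)
      (fun t ht => hb' t (hsub₂ ht)) hpos q
    refine ⟨insert p' F, Finset.subset_insert _ _, p₁, c, y, x, ?_, hfaces, hrest⟩
    have : (((N.erase z).erase v : Finset W) : Set W) ∪ {z, v} = N := by
      ext w
      simp only [Finset.coe_erase, mem_union, Set.mem_sdiff, mem_singleton_iff, mem_insert_iff,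
        Finset.mem_coe]
      constructor
      · rintro (h | rfl | rfl)
        · exact h.1.1
        · exact hz
        · exact hv
      · tauto
    rwa [this] at hfit
  -- If the shared germ lies to the left of `p`, then `p` itself separates it from the touches.
  -- Otherwise the facing point moves to `p'`, with the touches between `p` and `p'`.
  rcases lt_or_gt_of_ne hne with hlt | hlt
  · have hb'p : b' ≤ p := not_lt.1 fun h => hbF' p hpF ⟨hlt, h⟩
    obtain ⟨a₁, ha₁⟩ := exists_between hp'.2
    obtain ⟨b₁, hb₁⟩ := exists_between ha₁.2
    exact key a₁ b₁ p hb₁.1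
      (fun t ht => ⟨(hp'.1.trans ha₁.1).trans_le ht.1, ht.2.trans_lt hb₁.2⟩)
      (fun h => (ha₁.1.trans_le h.1).false) (fun h => ((hp'.1.trans h.2).trans_le hb'p).false)
      (Or.inr ⟨hb₂.2.le.trans hb'p, hp'.1.trans ha₁.1⟩) (h.mono (Finset.subset_insert _ _))
  · have hbc : b ≤ c₀ := not_lt.1 fun h => hbF c₀ hc.2.1 ⟨hlt, h⟩
    obtain ⟨a₁, ha₁⟩ := exists_between hp'.1
    obtain ⟨b₁, hb₁⟩ := exists_between ha₁.2
    exact key a₁ b₁ p' hb₁.1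
      (fun t ht => ⟨ha₁.1.trans_le ht.1, ht.2.trans_lt (hb₁.2.trans hp'.2)⟩)
      (fun h => (h.2.trans_lt hb₁.2).false) (fun h => ((h.1.trans hp'.2).trans_le hbc).false)
      (Or.inl ⟨hb₁.2.le, (hp'.2.trans_le hbc).trans ha₂.1⟩) (h.of_mem_Ioo hb hp')

/-- The zigzag attached to all members of a configuration in which all face each other. -/
theorem Faces.exists_zigzag [DecidableEq W] {C : Finset W} (h : Faces O F d C L p)
    (hO : ∀ w e m t, O w e m t → m ∈ F) {k : ℕ} (hcard : C.card = k) (hk : 2 ≤ k) :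
    ∃ c x q, Fits O F k C d c ∧ x ∉ F ∧ (∀ᶠ t in 𝓝[>] q, Occ d c (!d) x t) ∧
      ∀ v ∈ C, ∃ e, ∀ᶠ t in 𝓝[>] e, Occ d c d (L v) t ∧ ∀ w, O w d (L v) t ↔ w = v := by
  obtain ⟨b, hpb, hbF, hb⟩ := h.exists_Ioo
  obtain ⟨a₁, ha₁⟩ := exists_between hpb
  obtain ⟨b₁, hb₁⟩ := exists_between ha₁.2
  have hsub₁ : Icc a₁ b₁ ⊆ Ioo p b := fun t ht => ⟨ha₁.1.trans_le ht.1, ht.2.trans_lt hb₁.2⟩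
  have hlen : ((C.image L).toList).length = k := by
    rw [Finset.length_toList, Finset.card_image_of_injOn h.1, hcard]
  obtain ⟨c, x, q, hgood, hlenc, hx, ho, hxq, hocc⟩ :=
    exists_zigzag_path F d (ls := (C.image L).toList) (Finset.nodup_toList _) (by omega) hb₁.1
  have ho' : ∀ v ∈ C, ∃ e, ∀ᶠ t in 𝓝[>] e, Occ d c d (L v) t ∧ ∀ w, O w d (L v) t ↔ w = v := by
    intro v hv
    obtain ⟨e, he, h⟩ := ho (L v) (Finset.mem_toList.2 (Finset.mem_image_of_mem _ hv))
    refine ⟨e, ?_⟩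
    filter_upwards [h, Ioo_mem_nhdsGT he.2] with t ht ht'
    exact ⟨ht, hb t (hsub₁ ⟨(he.1.trans ht'.1).le, ht'.2.le⟩) v hv⟩
  refine ⟨c, x, q, ⟨hgood, by omega, fun w => ⟨?_, fun hw => ?_⟩, ?_⟩, hx, hxq, ho'⟩
  · rintro ⟨e, m, t, h, hw⟩
    rcases hocc e m t h with ⟨rfl, hm, ht⟩ | hm
    · obtain ⟨v, hv, rfl⟩ := Finset.mem_image.1 (Finset.mem_toList.1 hm)
      obtain rfl := (hb t (hsub₁ ht) v hv w).1 hw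
      exact hv
    · exact absurd (hO _ _ _ _ hw) hm
  · obtain ⟨e, he⟩ := ho' w hw
    obtain ⟨t, ht⟩ := he.exists
    exact ⟨_, _, _, ht.1, (ht.2 w).2 rfl⟩
  · intro e m hm p hp
    filter_upwards [eventually_notMem_Icc (fun f hf hI => hbF f hf (hsub₁ hI)) hp] with t ht h
    rcases hocc e m t h with ⟨-, -, h⟩ | h
    · exact ht h
    · exact h hm

end Configurations

/-! ### Extending a layout vertex by vertex -/

section Layouts

variable {W : Type*} {O : W → Bool → ℚ → ℚ → Prop} {F F' : Finset ℚ} {k : ℕ} {N : Set W}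
  {d : Bool} {c : List ℚ} {u : W}

/-- Stability keeps the new path out of a right neighbourhood of each recorded point on each
recorded line, so the users there do not change. -/
theorem Fits.germ_update [DecidableEq W] (hc : Fits O F k N d c) (hu : ∀ e m t, ¬ O u e m t)
    (hFF : F ⊆ F') {e : Bool} {l p : ℚ} {S : Set W} (h : LineGerm O F e l p S) :
    LineGerm (Function.update O u (Occ d c)) F' e l p S := by
  refine ⟨hFF h.1, hFF h.2.1, ?_⟩
  filter_upwards [h.2.2, hc.stable e l h.1 p h.2.1] with t ht ht' w
  by_cases hw : w = u
  · subst hw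
    rw [Function.update_self, ← ht w]
    exact iff_of_false ht' (hu _ _ _)
  · rw [Function.update_of_ne hw, ht w]

theorem germ_update_self [DecidableEq W] (hO : ∀ w e m t, O w e m t → m ∈ F) {e : Bool}
    {y p : ℚ} (hy : y ∉ F) (hyF : y ∈ F') (hpF : p ∈ F') (h : ∀ᶠ t in 𝓝[>] p, Occ d c e y t) :
    LineGerm (Function.update O u (Occ d c)) F' e y p {u} := by
  refine ⟨hyF, hpF, ?_⟩
  filter_upwards [h] with t ht w
  by_cases hw : w = u
  · subst hw
    simpa using ht
  · rw [Function.update_of_ne hw, mem_singleton_iff]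
    exact iff_of_false (fun h => hy (hO _ _ _ _ h)) hw

theorem Fits.faces_update [DecidableEq W] (hc : Fits O F k N d c)
    (hO : ∀ w e m t, O w e m t → m ∈ F) (hu : ∀ e m t, ¬ O u e m t) (hFF : F ⊆ F') {e : Bool}
    {C : Set W} {L : W → ℚ} {p : ℚ} (hF : Faces O F e C L p) (huC : u ∉ C) {y : ℚ} (hy : y ∉ F)
    (hyF : y ∈ F') (hpF : p ∈ F') (h : ∀ᶠ t in 𝓝[>] p, Occ d c e y t) :
    Faces (Function.update O u (Occ d c)) F' e (insert u C) (Function.update L u y) p := by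
  have hL : ∀ v ∈ C, Function.update L u y v = L v := fun v hv =>
    Function.update_of_ne (fun h : v = u => huC (h ▸ hv)) _ _
  refine ⟨(injOn_insert huC).2 ⟨hF.1.congr fun v hv => (hL v hv).symm, ?_⟩, ?_⟩
  · rintro ⟨v, hv, hvy⟩
    rw [hL v hv, Function.update_self] at hvy
    exact hy (hvy ▸ (hF.2 v hv).1)
  · rintro v (rfl | hv)
    · rw [Function.update_self]
      exact germ_update_self hO hy hyF hpF h
    · rw [hL v hv]
      exact hc.germ_update hu hFF (hF.2 v hv)

/-- The result of adding a coordinate list to an arrangement. -/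
def ExistsConf [DecidableEq W] (O : W → Bool → ℚ → ℚ → Prop) (F : Finset ℚ) (k : ℕ) (N : Set W)
    (u : W) (C : Set W) : Prop :=
  ∃ F₁ ⊇ F, ∃ d c, Fits O F₁ k N d c ∧
    ∃ F₂ ⊇ F₁, Conf (Function.update O u (Occ d c)) F₂ (insert u C)

/-- Every clique configuration can be extended by a new vertex adjacent to any of the members. -/
theorem Conf.existsConf [Finite W] [DecidableEq W] {C : Finset W} (h : Conf O F C)
    (hO : ∀ w e m t, O w e m t → m ∈ F) (hu : ∀ e m t, ¬ O u e m t) (hk : 2 ≤ k)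
    (hC : C.card ≤ k) (huC : u ∉ C) {N : Finset W} (hN : N ⊆ C) :
    ExistsConf O F k N u C := by
  have hNk : N.card ≤ k := (Finset.card_le_card hN).trans hC
  have hfaces : ∀ {d L p}, Faces O F d C L p → ExistsConf O F k N u C := by
    intro d L p h
    rcases hNk.lt_or_eq with hlt | heq
    · obtain ⟨F₁, hF₁, p', c, y, x, hfit, hfaces, hy, -, hyp, -⟩ :=
        h.existsCrossing hO hk (N := N) hN hlt p
      refine ⟨F₁, hF₁, d, c, hfit, insert y (insert p' F₁), fun f hf => by simp [hf], d, Or.inl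
        ⟨_, p', hfit.faces_update (fun w e m t h => hF₁ (hO w e m t h)) hu
          (fun f hf => by simp [hf])
          hfaces (by simpa using huC) hy (by simp) (by simp) hyp⟩⟩
    · obtain rfl : N = C := Finset.eq_of_subset_of_card_le hN (by omega)
      obtain ⟨c, x, q, hfit, hx, hxq, hdouble⟩ := h.exists_zigzag hO heq hk
      choose! a ha using hdouble
      have hFF : F ⊆ insert x (insert q (F ∪ N.image a)) := fun f hf => by simp [hf]
      -- The zigzag `u` becomes the exceptional vertex with `R = N`. Outside `R` only `u` is left,
      -- so the constant function with value `x` serves as `M`.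
      refine ⟨F, subset_rfl, d, c, hfit, insert x (insert q (F ∪ N.image a)), hFF, d, Or.inr
        ⟨u, N, L, fun _ => x, p, q, mem_insert _ _, by simpa using huC, subset_insert _ _,
          ⟨h.1.mono ?_, fun v hv => hfit.germ_update hu hFF (h.2 v ?_)⟩, ⟨?_, ?_⟩, ?_⟩⟩
      · rintro v ⟨hv | hv, hvu⟩
        · exact absurd hv hvu
        · exact hv
      · exact hv.1.resolve_left hv.2
      · rintro v ⟨hv | hv, hvN⟩ w ⟨hw | hw, hwN⟩ -
        · exact hv.trans hw.symm
        · exact absurd hw hwN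
        · exact absurd hv hvN
        · exact absurd hv hvN
      · rintro v ⟨hv | hv, hvN⟩
        · rw [hv]
          exact germ_update_self hO hx (by simp) (by simp) hxq
        · exact absurd hv hvN
      · intro v hv
        refine ⟨a v, hFF (h.2 v hv).1, by
          simp only [Finset.mem_insert, Finset.mem_union, Finset.mem_image]
          exact Or.inr (Or.inr (Or.inr ⟨v, hv, rfl⟩)), ?_⟩
        filter_upwards [ha v hv] with t ht w
        by_cases hw : w = u
        · subst hw
          simpa using ht.1
        · rw [Function.update_of_ne hw, ht.2 w]
          simp [hw]
  obtain ⟨d, ⟨L, p, h⟩ | ⟨z, R, L, M, p, q, hz, hzR, hRC, h1, h2, h3⟩⟩ := h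
  · exact hfaces h
  rcases R.eq_empty_or_nonempty with rfl | ⟨r, hr⟩
  · exact hfaces (h2.subset (by simp))
  -- In all remaining cases `z` and `R` are kept, and the new vertex joins both facing families, on
  -- `y` in direction `d` and on `x` in the other one.
  have wrap : ∀ (F₁ : Finset ℚ) (d' : Bool) (c : List ℚ) (p' q' y x : ℚ), F ⊆ F₁ →
      Fits O F₁ k N d' c → Faces O F₁ d (C \ {z}) L p' → Faces O F₁ (!d) (C \ R) M q' →
      y ∉ F₁ → x ∉ F₁ → (∀ᶠ t in 𝓝[>] p', Occ d' c d y t) →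
      (∀ᶠ t in 𝓝[>] q', Occ d' c (!d) x t) → ExistsConf O F k N u C := by
    intro F₁ d' c p' q' y x hF₁ hfit hf hf' hy hx hyp hxq
    have hFF : F₁ ⊆ insert y (insert p' (insert x (insert q' F₁))) := fun f hf => by simp [hf]
    have hO₁ : ∀ w e m t, O w e m t → m ∈ F₁ := fun w e m t h => hF₁ (hO w e m t h)
    have huz : u ≠ z := fun h => huC (h ▸ hz)
    have huR : u ∉ R := fun h => huC (hRC h)
    refine ⟨F₁, hF₁, d', c, hfit, _, hFF, d, Or.inr ⟨z, R, _, _, p', q', mem_insert_of_mem _ hz,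
      hzR, hRC.trans (subset_insert _ _),
      (hfit.faces_update hO₁ hu hFF hf (fun h => huC h.1) hy (by simp) (by simp) hyp).subset ?_,
      (hfit.faces_update hO₁ hu hFF hf' (fun h => huC h.1) hx (by simp) (by simp) hxq).subset ?_,
      fun v hv => ?_⟩⟩
    · rintro v ⟨hv | hv, hvz⟩
      · exact Or.inl hv
      · exact Or.inr ⟨hv, hvz⟩
    · rintro v ⟨hv | hv, hvz⟩
      · exact Or.inl hv
      · exact Or.inr ⟨hv, hvz⟩
    · obtain ⟨c₀, hc₀⟩ := h3 v hv
      rw [Function.update_of_ne (fun h : v = u => huR (h ▸ hv))]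
      exact ⟨c₀, hfit.germ_update hu hFF (hc₀.mono hF₁)⟩
  by_cases hzN : z ∈ N
  · by_cases hNR : ∃ v ∈ N, v ∈ R
    · obtain ⟨v, hv, hvR⟩ := hNR
      obtain ⟨c₀, hc₀⟩ := h3 v hvR
      obtain ⟨F₁, hF₁, p', c, y, x, hfit, hf, hy, hx, hyp, hxq⟩ :=
        h1.existsCrossing_of_germ hO (N := N) hN hNk hzN hv (fun h => hzR (h ▸ hvR)) hc₀ q
      exact wrap F₁ d c p' q y x hF₁ hfit hf (h2.mono hF₁) hy hx hyp hxq
    -- The neighbours avoid `R`, so they face each other in direction `!d` and the crossing path is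
    -- used with the directions exchanged. As `r` is not a neighbour, there are fewer than `k` of
    -- them.
    · push Not at hNR
      have hlt : N.card + 1 ≤ k := by
        refine (Finset.card_lt_card ⟨hN, fun h => hNR r (h (hRC hr)) hr⟩).trans_le hC
      obtain ⟨F₁, hF₁, q', c, x, y, hfit, hf, hx, hy, hxq, hyp⟩ :=
        h2.existsCrossing hO hk (N := N) (fun v hv => ⟨hN hv, hNR v hv⟩) hlt p
      rw [Bool.not_not] at hyp
      exact wrap F₁ (!d) c p q' y x hF₁ hfit (h1.mono hF₁) hf hy hx hyp hxq
  · have hlt : N.card + 1 ≤ k :=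
      (Finset.card_lt_card ⟨hN, fun h => hzN (h hz)⟩).trans_le hC
    obtain ⟨F₁, hF₁, p', c, y, x, hfit, hf, hy, hx, hyp, hxq⟩ :=
      h1.existsCrossing hO hk (N := N) (fun v hv => ⟨hN hv, fun h => hzN (h ▸ hv)⟩) hlt q
    exact wrap F₁ d c p' q y x hF₁ hfit hf (h2.mono hF₁) hy hx hyp hxq

/-- The occupancy of the path with direction and coordinate list `P v`. -/
def occOf (P : W → Bool × List ℚ) (v : W) : Bool → ℚ → ℚ → Prop := Occ (P v).1 (P v).2

/-- Coordinate lists for the vertices in `s` that represent `G`, with a configuration for each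
small clique of `H`. -/
structure Layout (G H : SimpleGraph W) (k : ℕ) (s : Finset W) (P : W → Bool × List ℚ)
    (F : Finset ℚ) : Prop where
  good : ∀ v, Good (P v).2
  length_le : ∀ v, (P v).2.length ≤ 2 * k + 1
  mem : ∀ v, ∀ x ∈ (P v).2, x ∈ F
  eq_nil : ∀ v ∉ s, (P v).2 = []
  adj_iff : ∀ v ∈ s, ∀ w ∈ s, v ≠ w →
    (G.Adj v w ↔ ∃ e m t, occOf P v e m t ∧ occOf P w e m t)
  conf : ∀ E ⊆ s, H.IsClique E → E.card ≤ k → Conf (occOf P) F E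

theorem layout_empty (G H : SimpleGraph W) (k : ℕ) : Layout G H k ∅ (fun _ => (true, [])) ∅ where
  good v := by simp [Good, evens]
  length_le v := by simp
  mem v x := by simp
  eq_nil v _ := rfl
  adj_iff v hv := by simp at hv
  conf E hE _ _ := by
    obtain rfl := Finset.subset_empty.1 hE
    exact ⟨true, Or.inl ⟨fun _ => 0, 0, by simp, by simp⟩⟩

/-- Configurations belong to cliques of `H`, whereas the path of `u` has to meet only its neighbours
in `G`. A clique through `u` lies in `insert u C` and inherits its configuration; any other clique
keeps its old germs. -/
theorem Layout.exists_insert [Finite W] [DecidableEq W] {G H : SimpleGraph W} {s : Finset W}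
    {P : W → Bool × List ℚ} (h : Layout G H k s P F) (hk : 2 ≤ k) (hGH : G ≤ H) (hus : u ∉ s)
    {C : Finset W} (hCs : C ⊆ s) (hC : H.IsClique C) (hCk : C.card ≤ k)
    (hadj : ∀ w ∈ s, H.Adj u w → w ∈ C) : ∃ P' F', Layout G H k (insert u s) P' F' := by
  classical
  have hO : ∀ w e m t, occOf P w e m t → m ∈ F := fun w e m t ht => h.mem w m ht.mem
  have hu : ∀ e m t, ¬ occOf P u e m t := fun e m t ht => by
    unfold occOf at ht
    rw [h.eq_nil u hus] at ht
    exact ht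
  obtain ⟨F₁, hF₁, d, c, hfit, F₂, hF₂, hconf⟩ := (h.conf C hCs hC hCk).existsConf hO hu hk hCk
    (fun h => hus (hCs h)) (N := C.filter (G.Adj u)) (Finset.filter_subset _ _)
  have hupd : occOf (Function.update P u (d, c)) = Function.update (occOf P) u (Occ d c) := by
    funext w
    by_cases hw : w = u
    · subst hw
      simp [occOf]
    · simp [occOf, Function.update_of_ne hw]
  have hmeet : ∀ w ∈ s, G.Adj u w ↔ ∃ e m t, Occ d c e m t ∧ occOf P w e m t := by
    intro w hw
    rw [hfit.meets w]
    simp only [Finset.coe_filter, mem_ofPred_eq]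
    exact ⟨fun h => ⟨hadj w hw (hGH h), h⟩, fun h => h.2⟩
  have hconfmono : ∀ {O : W → Bool → ℚ → ℚ → Prop} {F F' : Finset ℚ} {C : Set W}, F ⊆ F' →
      Conf O F C → Conf O F' C := by
    rintro O F F' C hF ⟨d, ⟨L, p, h⟩ | ⟨z, R, L, M, p, q, hz, hzR, hRC, h1, h2, h3⟩⟩
    · exact ⟨d, Or.inl ⟨L, p, h.mono hF⟩⟩
    · exact ⟨d, Or.inr ⟨z, R, L, M, p, q, hz, hzR, hRC, h1.mono hF, h2.mono hF,
        fun v hv => (h3 v hv).imp fun _ h => h.mono hF⟩⟩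
  refine ⟨Function.update P u (d, c), F₂ ∪ c.toFinset, ?_, ?_, ?_, ?_, ?_, ?_⟩
  · intro v
    by_cases hv : v = u
    · subst hv
      simpa using hfit.good
    · rw [Function.update_of_ne hv]
      exact h.good v
  · intro v
    by_cases hv : v = u
    · subst hv
      simpa using hfit.length_le
    · rw [Function.update_of_ne hv]
      exact h.length_le v
  · intro v x hx
    by_cases hv : v = u
    · subst hv
      simp at hx ⊢
      exact Or.inr hx
    · rw [Function.update_of_ne hv] at hx
      exact Finset.mem_union_left _ (hF₂ (hF₁ (h.mem v x hx)))
  · intro v hv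
    rw [Finset.mem_insert, not_or] at hv
    rw [Function.update_of_ne hv.1]
    exact h.eq_nil v hv.2
  · intro v hv w hw hvw
    rw [hupd]
    rcases Finset.mem_insert.1 hv with rfl | hvs
    · have hws := (Finset.mem_insert.1 hw).resolve_left hvw.symm
      rw [Function.update_self, Function.update_of_ne hvw.symm]
      exact hmeet w hws
    · have hvu : v ≠ u := fun h => hus (h ▸ hvs)
      rcases Finset.mem_insert.1 hw with rfl | hws
      · rw [Function.update_self, Function.update_of_ne hvw, G.adj_comm, hmeet v hvs]
        simp only [and_comm]
      · rw [Function.update_of_ne hvu, Function.update_of_ne (fun h : w = u => hus (h ▸ hws))]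
        exact h.adj_iff v hvs w hws hvw
  · intro E hE hEc hEk
    rw [hupd]
    by_cases huE : u ∈ E
    · refine (hconfmono Finset.subset_union_left hconf).subset fun w hw => ?_
      by_cases hwu : w = u
      · exact Or.inl hwu
      · exact Or.inr (hadj w ((Finset.mem_insert.1 (hE hw)).resolve_left hwu)
          (hEc huE hw (Ne.symm hwu)))
    · have hEs : E ⊆ s := fun w hw =>
        (Finset.mem_insert.1 (hE hw)).resolve_left fun h => huE (h ▸ hw)
      have hFF : F₁ ⊆ F₂ ∪ c.toFinset := hF₂.trans Finset.subset_union_left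
      have hg : ∀ {e l p S}, LineGerm (occOf P) F e l p S →
          LineGerm (Function.update (occOf P) u (Occ d c)) (F₂ ∪ c.toFinset) e l p S :=
        fun h => hfit.germ_update hu hFF (h.mono hF₁)
      obtain ⟨d, ⟨L, p, h⟩ | ⟨z, R, L, M, p, q, hz, hzR, hRC, h1, h2, h3⟩⟩ := h.conf E hEs hEc hEk
      · exact ⟨d, Or.inl ⟨L, p, h.1, fun v hv => hg (h.2 v hv)⟩⟩
      · exact ⟨d, Or.inr ⟨z, R, L, M, p, q, hz, hzR, hRC, ⟨h1.1, fun v hv => hg (h1.2 v hv)⟩,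
          ⟨h2.1, fun v hv => hg (h2.2 v hv)⟩, fun v hv => (h3 v hv).imp fun _ h => hg h⟩⟩

theorem Layout.exists_of_isClique [Finite W] [DecidableEq W] {G H : SimpleGraph W} (hk : 2 ≤ k)
    (hGH : G ≤ H) {s : Finset W} (hs : H.IsClique s) (hcard : s.card ≤ k + 1) :
    ∃ P F, Layout G H k s P F := by
  induction s using Finset.induction_on with
  | empty => exact ⟨_, _, layout_empty G H k⟩
  | insert u s hus ih =>
    rw [Finset.card_insert_of_notMem hus] at hcard
    have hs' : H.IsClique s := hs.subset (by simp)
    obtain ⟨P, F, h⟩ := ih hs' (by omega)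
    exact h.exists_insert hk hGH hus subset_rfl hs' (by omega) fun w hw _ => hw

/-- Allowing `k' ≤ k` makes it unnecessary to embed `k'`-trees into `k`-trees. -/
theorem KTreeBuilt.exists_layout [Finite W] [DecidableEq W] {G H : SimpleGraph W} {k' : ℕ}
    {s : Finset W} (h : KTreeBuilt k' H s) (hk : 2 ≤ k) (hk' : k' ≤ k) (hGH : G ≤ H) :
    ∃ P F, Layout G H k s P F := by
  induction h with
  | base s hs => exact Layout.exists_of_isClique hk hGH hs.1 (by rw [hs.2]; omega)
  | attach s v hv c hcs hc hadj hs ih =>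
    obtain ⟨P, F, h⟩ := ih
    rw [Finset.cons_eq_insert]
    exact h.exists_insert hk hGH hv hcs hc.1 (by rw [hc.2]; exact hk')
      fun w hw hvw => (hadj w hw).1 hvw

end Layouts

/-! ### From coordinate lists to grid paths -/

/-- The grid-point with coordinates `a` along and `b` across direction `d`. -/
def gridPoint (d : Bool) (a b : ℤ) : ℤ × ℤ := if d then (a, b) else (b, a)

/-- The grid-edge from `n` to `n + 1` on the line `b` of direction `d`. -/
def gridEdge (d : Bool) (b n : ℤ) : Sym2 (ℤ × ℤ) := s(gridPoint d n b, gridPoint d (n + 1) b)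

theorem gridPoint_not (d : Bool) (a b : ℤ) : gridPoint (!d) b a = gridPoint d a b := by
  cases d <;> rfl

theorem gridEdge_inj {d d' : Bool} {b b' n n' : ℤ} :
    gridEdge d b n = gridEdge d' b' n' ↔ d = d' ∧ b = b' ∧ n = n' := by
  constructor
  · intro h
    cases d <;> cases d' <;> simp [gridEdge, gridPoint] at h ⊢ <;> omega
  · rintro ⟨rfl, rfl, rfl⟩
    rfl

theorem gridPoint_adj (d : Bool) (a b : ℤ) :
    planeGrid.Adj (gridPoint d a b) (gridPoint d (a + 1) b) := by
  rw [planeGrid_adj]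
  cases d <;> simp [gridPoint]

theorem exists_straight_walk_nat (d : Bool) (b : ℤ) (n : ℕ) (a : ℤ) :
    ∃ w : planeGrid.Walk (gridPoint d a b) (gridPoint d (a + n) b),
      (∀ x ∈ w.darts, isHorizontalDart x = d) ∧ w.IsTrail ∧
      ∀ e, e ∈ w.edges ↔ ∃ m, a ≤ m ∧ m < a + n ∧ e = gridEdge d b m := by
  induction n generalizing a with
  | zero =>
    refine ⟨SimpleGraph.Walk.nil.copy rfl (by simp), by simp, by simp, fun e => ?_⟩
    simp only [SimpleGraph.Walk.edges_copy, SimpleGraph.Walk.edges_nil, List.not_mem_nil,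
      false_iff, not_exists]
    intro m hm
    simp at hm
    omega
  | succ n ih =>
    obtain ⟨w, h1, h2, h3⟩ := ih (a + 1)
    refine ⟨(SimpleGraph.Walk.cons (gridPoint_adj d a b) w).copy rfl (by push_cast; ring_nf),
      ?_, ?_, ?_⟩
    · simp only [SimpleGraph.Walk.darts_copy, SimpleGraph.Walk.darts_cons, List.mem_cons,
        forall_eq_or_imp]
      refine ⟨?_, h1⟩
      cases d <;> simp [isHorizontalDart, gridPoint]
    · rw [SimpleGraph.Walk.isTrail_copy, SimpleGraph.Walk.isTrail_cons]
      refine ⟨h2, fun h => ?_⟩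
      obtain ⟨m, hm, -, he⟩ := (h3 _).1 h
      have := (gridEdge_inj.1 he).2.2
      omega
    · intro e
      rw [SimpleGraph.Walk.edges_copy, SimpleGraph.Walk.edges_cons, List.mem_cons, h3]
      constructor
      · rintro (rfl | ⟨m, hm, hm', rfl⟩)
        · exact ⟨a, le_rfl, by push_cast; omega, rfl⟩
        · exact ⟨m, by omega, by push_cast; omega, rfl⟩
      · rintro ⟨m, hm, hm', rfl⟩
        rcases hm.eq_or_lt with rfl | hlt
        · exact Or.inl rfl
        · exact Or.inr ⟨m, by omega, by push_cast at hm'; omega, rfl⟩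

theorem exists_straight_walk (d : Bool) (b a a' : ℤ) :
    ∃ w : planeGrid.Walk (gridPoint d a b) (gridPoint d a' b),
      (∀ x ∈ w.darts, isHorizontalDart x = d) ∧ w.IsTrail ∧
      ∀ e, e ∈ w.edges ↔ ∃ m, min a a' ≤ m ∧ m < max a a' ∧ e = gridEdge d b m := by
  rcases le_total a a' with h | h
  · obtain ⟨n, rfl⟩ := Int.le.dest h
    obtain ⟨w, h1, h2, h3⟩ := exists_straight_walk_nat d b n a
    exact ⟨w, h1, h2, fun e => by simpa [min_eq_left h, max_eq_right h] using h3 e⟩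
  · obtain ⟨n, rfl⟩ := Int.le.dest h
    obtain ⟨w, h1, h2, h3⟩ := exists_straight_walk_nat d b n a'
    refine ⟨w.reverse, fun x hx => ?_, h2.reverse, fun e => ?_⟩
    · rw [SimpleGraph.Walk.mem_darts_reverse] at hx
      rw [← h1 _ hx]
      simp [isHorizontalDart, eq_comm]
    · rw [SimpleGraph.Walk.edges_reverse, List.mem_reverse, h3, min_eq_right h, max_eq_left h]

theorem switchCount_eq_zero {l : List Bool} {d : Bool} (h : ∀ x ∈ l, x = d) :
    switchCount l = 0 := by
  induction l with
  | nil => rfl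
  | cons a l ih =>
    cases l with
    | nil => rfl
    | cons b l =>
      have := ih fun x hx => h x (List.mem_cons_of_mem _ hx)
      have hab : a = b := (h a (by simp)).trans (h b (by simp)).symm
      simp [switchCount, this, hab]

theorem switchCount_append_le {l : List Bool} {d : Bool} (h : ∀ x ∈ l, x = d) (l' : List Bool) :
    switchCount (l ++ l') ≤ switchCount l' + 1 := by
  induction l with
  | nil => simp
  | cons a l ih =>
    have ih := ih fun x hx => h x (List.mem_cons_of_mem _ hx)
    cases l with
    | nil =>
      cases l' with
      | nil => simp [switchCount]
      | cons b l' =>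
        simp only [List.cons_append, List.nil_append, switchCount]
        split_ifs <;> omega
    | cons b l =>
      simpa [switchCount, h a (by simp), h b (by simp)] using ih

theorem occ_line_cases {d : Bool} {a b : ℚ} {l : List ℚ} {e : Bool} {m t : ℚ}
    (h : Occ d (a :: b :: l) e m t) : (e = d ∧ m ∈ evens (b :: l)) ∨ (e = !d ∧ m ∈ evens l) := by
  induction l generalizing d a b with
  | nil => exact h.elim
  | cons c l ih =>
    rcases h with ⟨rfl, rfl, -⟩ | h
    · exact Or.inl ⟨rfl, by simp [evens]⟩
    · rcases ih h with ⟨h1, h2⟩ | ⟨h1, h2⟩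
      · exact Or.inr ⟨h1, h2⟩
      · exact Or.inl ⟨by simpa using h1, by simp [evens, h2]⟩

theorem Good.tail {a : ℚ} {l : List ℚ} (h : Good (a :: l)) : Good l := by
  refine ⟨h.2, ?_⟩
  have := h.1
  match l with
  | [] => simp [evens]
  | b :: l => exact this.of_cons

theorem mem_Ioo_add_half {a c n : ℤ} :
    ((n : ℚ) + 1 / 2) ∈ Ioo (min (a : ℚ) c) (max (a : ℚ) c) ↔ min a c ≤ n ∧ n < max a c := by
  rw [← Int.cast_min, ← Int.cast_max, mem_Ioo]
  generalize min a c = x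
  generalize max a c = y
  constructor
  · rintro ⟨h1, h2⟩
    constructor
    · have : (x : ℚ) < (n + 1 : ℤ) := by push_cast; linarith
      have := Int.cast_lt.1 this
      omega
    · have : (n : ℚ) < y := by linarith
      exact Int.cast_lt.1 this
  · rintro ⟨h1, h2⟩
    have h1 : (x : ℚ) ≤ n := Int.cast_le.2 h1
    have h2 : ((n + 1 : ℤ) : ℚ) ≤ y := Int.cast_le.2 h2
    push_cast at h2
    exact ⟨by linarith, by linarith⟩

/-- Unit edges are identified with their midpoints `n + 1 / 2`. `Good` makes the walk a trail, as
segments of equal direction lie on different lines. -/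
theorem exists_walk_of_good (d : Bool) (a b : ℤ) (l : List ℤ)
    (h : Good ((a :: b :: l).map Int.cast)) :
    ∃ (v : ℤ × ℤ) (w : planeGrid.Walk (gridPoint d a b) v), w.IsTrail ∧
      switchCount (w.darts.map isHorizontalDart) ≤ l.length - 1 ∧
      ∀ e, e ∈ w.edges ↔ ∃ (d' : Bool) (m n : ℤ), e = gridEdge d' m n ∧
        Occ d ((a :: b :: l).map Int.cast) d' m (n + 1 / 2) := by
  induction l generalizing d a b with
  | nil =>
    refine ⟨_, .nil, by simp, by simp [switchCount], fun e => ?_⟩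
    simp [not_occ_pair]
  | cons c l ih =>
    obtain ⟨w, h1, h2, h3⟩ := exists_straight_walk d b a c
    obtain ⟨v, w', h1', h2', h3'⟩ := ih (!d) b c h.tail
    have hlast : gridPoint (!d) b c = gridPoint d c b := gridPoint_not d c b
    refine ⟨v, w.append (w'.copy hlast rfl), ?_, ?_, ?_⟩
    · rw [SimpleGraph.Walk.isTrail_def, SimpleGraph.Walk.edges_append, List.nodup_append',
        SimpleGraph.Walk.edges_copy]
      refine ⟨h2.edges_nodup, h1'.edges_nodup, fun e he he' => ?_⟩
      obtain ⟨m, -, -, rfl⟩ := (h3 e).1 he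
      obtain ⟨d', m', n', heq, hocc⟩ := (h3' _).1 he'
      obtain ⟨rfl, rfl, -⟩ := gridEdge_inj.1 heq
      rcases occ_line_cases hocc with ⟨hd, -⟩ | ⟨-, hm⟩
      · simp at hd
      · exact (List.nodup_cons.1 h.tail.1).1 hm
    · rw [SimpleGraph.Walk.darts_append, List.map_append, SimpleGraph.Walk.darts_copy]
      have hall : ∀ x ∈ w.darts.map isHorizontalDart, x = d := by simpa using h1
      have := switchCount_append_le hall (w'.darts.map isHorizontalDart)
      cases l with
      -- Only one segment remains: the walk `w'` is empty, so the general estimate, which allows for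
      -- one more bend, has to be replaced.
      | nil =>
        have hnil : w'.darts = [] := by
          rw [← List.map_eq_nil_iff (f := SimpleGraph.Dart.edge), List.eq_nil_iff_forall_not_mem]
          intro e he
          obtain ⟨_, _, _, -, hocc⟩ := (h3' e).1 he
          exact hocc
        rw [hnil, List.map_nil, List.append_nil, switchCount_eq_zero hall]
        simp
      | cons x l =>
        simp only [List.length_cons] at h2' ⊢
        omega
    · intro e
      rw [SimpleGraph.Walk.edges_append, List.mem_append, SimpleGraph.Walk.edges_copy, h3, h3']
      constructor
      · rintro (⟨m, hm, hm', rfl⟩ | ⟨d', m, n, rfl, hocc⟩)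
        · exact ⟨d, b, m, rfl, Or.inl ⟨rfl, rfl, mem_Ioo_add_half.2 ⟨hm, hm'⟩⟩⟩
        · exact ⟨d', m, n, rfl, Or.inr hocc⟩
      · rintro ⟨d', m, n, rfl, ⟨rfl, hm, hn⟩ | hocc⟩
        · obtain rfl := Int.cast_injective hm
          obtain ⟨h4, h5⟩ := mem_Ioo_add_half.1 hn
          exact Or.inl ⟨n, h4, h5, rfl⟩
        · exact Or.inr ⟨d', m, n, rfl, hocc⟩

theorem exists_gridPath_of_good (d : Bool) (l : List ℤ) (h : Good (l.map Int.cast)) :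
    ∃ P : GridPath, P.bends ≤ l.length - 3 ∧
      ∀ e, e ∈ P.edgeSet ↔ ∃ (d' : Bool) (m n : ℤ), e = gridEdge d' m n ∧
        Occ d (l.map Int.cast) d' m (n + 1 / 2) := by
  match l with
  | [] =>
    refine ⟨⟨0, 0, .nil, by simp⟩, by simp [GridPath.bends, switchCount], fun e => ?_⟩
    simp [GridPath.edgeSet, not_occ_nil]
  | [a] =>
    refine ⟨⟨0, 0, .nil, by simp⟩, by simp [GridPath.bends, switchCount], fun e => ?_⟩
    simp [GridPath.edgeSet, not_occ_singleton]
  | a :: b :: l =>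
    obtain ⟨v, w, h1, h2, h3⟩ := exists_walk_of_good d a b l h
    exact ⟨⟨_, _, w, h1⟩, by simpa [GridPath.bends] using h2, h3⟩

/-- An open interval with integer ends that contains `t` also contains `⌊t⌋ + 1 / 2`. Hence two
integral paths that share any interior point of segments on a line share a whole grid-edge. -/
theorem Occ.floor {d : Bool} {l : List ℤ} {e : Bool} {m t : ℚ}
    (h : Occ d (l.map Int.cast) e m t) :
    ∃ m' : ℤ, m = m' ∧ Occ d (l.map Int.cast) e m' (⌊t⌋ + 1 / 2) := by
  induction l generalizing d with
  | nil => exact h.elim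
  | cons a l ih =>
    match l with
    | [] => exact h.elim
    | [b] => exact h.elim
    | b :: c :: l =>
      rcases h with ⟨rfl, rfl, h⟩ | h
      · refine ⟨b, rfl, Or.inl ⟨rfl, rfl, mem_Ioo_add_half.2 ?_⟩⟩
        rw [← Int.cast_min, ← Int.cast_max] at h
        refine ⟨Int.le_floor.2 h.1.le, Int.floor_lt.2 h.2⟩
      · obtain ⟨m', hm, h⟩ := ih h
        exact ⟨m', hm, Or.inr h⟩

theorem occ_map_mul {N : ℚ} (hN : 0 < N) {d : Bool} {l : List ℚ} {e : Bool} {m t : ℚ} :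
    Occ d (l.map (N * ·)) e (N * m) (N * t) ↔ Occ d l e m t := by
  induction l generalizing d with
  | nil => rfl
  | cons a l ih =>
    match l with
    | [] => rfl
    | [b] => rfl
    | b :: c :: l =>
      simp only [List.map_cons, occ_cons] at ih ⊢
      rw [ih]
      refine or_congr (and_congr Iff.rfl (and_congr ?_ ?_)) Iff.rfl
      · exact mul_right_inj' hN.ne'
      · rw [mem_Ioo, mem_Ioo, ← mul_min_of_nonneg _ _ hN.le, ← mul_max_of_nonneg _ _ hN.le,
          mul_lt_mul_iff_right₀ hN, mul_lt_mul_iff_right₀ hN]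

theorem evens_map (f : ℚ → ℚ) (l : List ℚ) : evens (l.map f) = (evens l).map f := by
  induction l using evens.induct with
  | case1 => rfl
  | case2 => rfl
  | case3 a b l ih => simp [evens, ih]

theorem Good.map_mul {N : ℚ} (hN : 0 < N) {l : List ℚ} (h : Good l) : Good (l.map (N * ·)) := by
  have hinj : Function.Injective (N * ·) := mul_right_injective₀ hN.ne'
  refine ⟨?_, ?_⟩
  · rw [evens_map]
    exact h.1.map hinj
  · rw [← List.map_tail, evens_map]
    exact h.2.map hinj

theorem exists_common_denominator (F : Finset ℚ) :
    ∃ N : ℚ, 0 < N ∧ ∀ f ∈ F, ∃ z : ℤ, N * f = z := by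
  refine ⟨((∏ f ∈ F, f.den : ℕ) : ℚ), ?_, fun f hf => ?_⟩
  · exact_mod_cast Finset.prod_pos fun f (_ : f ∈ F) => Rat.den_pos f
  · obtain ⟨c, hc⟩ := Finset.dvd_prod_of_mem (fun f : ℚ => f.den) hf
    refine ⟨c * f.num, ?_⟩
    rw [hc]
    push_cast
    have := Rat.den_mul_eq_num f
    rw [← this]
    ring

theorem Layout.exists_gridPaths {W : Type*} {G H : SimpleGraph W} {k : ℕ} {s : Finset W}
    {P : W → Bool × List ℚ} {F : Finset ℚ} (h : Layout G H k s P F) :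
    ∃ Q : W → GridPath, (∀ v, (Q v).bends ≤ 2 * k - 2) ∧
      ∀ v ∈ s, ∀ w ∈ s, v ≠ w → (G.Adj v w ↔ ((Q v).edgeSet ∩ (Q w).edgeSet).Nonempty) := by
  obtain ⟨N, hN, hint⟩ := exists_common_denominator F
  have hz : ∀ v, ∃ z : List ℤ, z.map (Int.cast : ℤ → ℚ) = (P v).2.map (N * ·) := by
    intro v
    have hmem := h.mem v
    generalize (P v).2 = c at hmem
    induction c with
    | nil => exact ⟨[], rfl⟩
    | cons a l ih =>
      obtain ⟨z, hz⟩ := ih fun x hx => hmem x (List.mem_cons_of_mem _ hx)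
      obtain ⟨y, hy⟩ := hint a (hmem a (by simp))
      exact ⟨y :: z, by simp [hz, hy]⟩
  choose z hz using hz
  choose Q hQ hQe using fun v => exists_gridPath_of_good (P v).1 (z v)
    (by rw [hz]; exact (h.good v).map_mul hN)
  refine ⟨Q, fun v => (hQ v).trans ?_, fun v hv w hw hvw => ?_⟩
  · have h1 := congrArg List.length (hz v)
    have h2 := h.length_le v
    simp only [List.length_map] at h1
    omega
  · rw [h.adj_iff v hv w hw hvw]
    constructor
    · rintro ⟨e, m, t, hv, hw⟩
      unfold occOf at hv hw
      rw [← occ_map_mul hN, ← hz] at hv hw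
      obtain ⟨m', hm, hv⟩ := hv.floor
      obtain ⟨m'', hm', hw⟩ := hw.floor
      obtain rfl : m' = m'' := Int.cast_injective (hm.symm.trans hm')
      exact ⟨gridEdge e m' _, (hQe v _).2 ⟨_, _, _, rfl, hv⟩, (hQe w _).2 ⟨_, _, _, rfl, hw⟩⟩
    · rintro ⟨x, hxv, hxw⟩
      obtain ⟨e, m, n, rfl, hv⟩ := (hQe v _).1 hxv
      obtain ⟨e', m', n', heq, hw⟩ := (hQe w _).1 hxw
      obtain ⟨rfl, rfl, rfl⟩ := gridEdge_inj.1 heq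
      have hm : (m : ℚ) = N * (m / N) := by field_simp
      have hn : (n : ℚ) + 1 / 2 = N * ((n + 1 / 2) / N) := by field_simp
      rw [hz, hm, hn, occ_map_mul hN] at hv hw
      exact ⟨_, _, _, hv, hw⟩

/-! ### Conclusion -/

theorem hasBendRepresentation_of_isPartialKTree {V : Type*} {G : SimpleGraph V} {k k' : ℕ}
    (hk : 2 ≤ k) (hk' : k' ≤ k) (h : IsPartialKTree k' G) :
    HasBendRepresentation (2 * k - 2) G := by
  obtain ⟨n, H, ⟨s, hs, hbuilt⟩, ⟨f, hf⟩⟩ := h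
  let φ : V ↪ Fin n := ⟨f, hf⟩
  have hGH : G.map φ ≤ H := by
    rw [SimpleGraph.map_le_iff_le_comap]
    exact fun v w hvw => f.map_adj hvw
  obtain ⟨P, F, hlayout⟩ := hbuilt.exists_layout hk hk' hGH
  obtain ⟨Q, hQ, hQadj⟩ := hlayout.exists_gridPaths
  refine ⟨fun v => Q (φ v), fun v w hvw => ?_, fun v => hQ _⟩
  rw [← hQadj _ (hs _) _ (hs _) (φ.injective.ne hvw), SimpleGraph.map_adj_apply]

theorem exists_isPartialKTree_of_treewidth_le {V : Type*} {G : SimpleGraph V} {k : ℕ}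
    (h : treewidth G ≤ k) : ∃ k' ≤ k, IsPartialKTree k' G := by
  by_contra! hcon
  have : ((k + 1 : ℕ) : ℕ∞) ≤ treewidth G := by
    refine le_iInf₂ fun k' hk' => ?_
    have : k < k' := not_le.1 fun hle => hcon k' hle hk'
    exact_mod_cast this
  have := Nat.cast_le.1 (this.trans h)
  omega

theorem bendNumber_le_of_treewidth_le {V : Type*} {G : SimpleGraph V} {k : ℕ} (hk : 2 ≤ k)
    (h : treewidth G ≤ k) : bendNumber G ≤ ((2 * k - 2 : ℕ) : ℕ∞) := by
  obtain ⟨k', hk', hG⟩ := exists_isPartialKTree_of_treewidth_le h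
  exact iInf₂_le (f := fun (k : ℕ) (_ : HasBendRepresentation k G) => (k : ℕ∞)) _
    (hasBendRepresentation_of_isPartialKTree hk hk' hG)

end CoordinateLists

theorem mainTheorem5 (k : ℕ) (hk : 2 ≤ k) :
    (∀ (V : Type*) [Finite V] (G : SimpleGraph V),
      treewidth G ≤ (k : ℕ∞) → bendNumber G ≤ ((2 * k - 2 : ℕ) : ℕ∞)) ∧
    (∃ (n : ℕ) (G : SimpleGraph (Fin n)),
      treewidth G = (k : ℕ∞) ∧ bendNumber G = ((2 * k - 2 : ℕ) : ℕ∞)) := by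
  refine ⟨fun V _ G hG => bendNumber_le_of_treewidth_le hk hG, ?_⟩
  let N := ((k * (2 * k - 2)) ^ 2 + 2 * k) * 4 + 1
  have htw : treewidth (bipartiteFin k N) = k := treewidth_bipartiteFin (by omega) (by
    simp only [N]
    have := Nat.zero_le ((k * (2 * k - 2)) ^ 2)
    omega)
  exact ⟨k + N, bipartiteFin k N, htw, le_antisymm (bendNumber_le_of_treewidth_le hk htw.le)
    (le_bendNumber_bipartiteFin (Nat.lt_succ_self _))⟩
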